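/- **Setting.** Let $A\in\mathbb{R}^{n\times n}$ and $C\in\mathbb{R}^{m\times n}$ be such that $(C,A)$ is observable and $A$ has at least one (complex) eigenvalue of modulus greater than $1$. Consider the system $$X(t+1)=AX(t)+V(t),\qquad Y(t)=CX(t)+W(t),\qquad t=0,1,2,\dots$$ *Channel.* Let $\mathcal X$ be a finite alphabet with $q=|\mathcal X|\ge 2$, and let $\log$ be the logarithm to base $q$. A finite-state erasure channel is given by a directed graph $(\mathcal S,\mathcal E)$, $\mathcal E\subseteq\mathcal S\times\mathcal S$, on a finite nonempty state set $\mathcal S$, which is strongly connected (there is a walk with at least one edge from any state to any state), and by a label $v\in\{0,1\}$ on each edge such that distinct edges leaving the same state have distinct labels. Its noise sequences are the label sequences $(z(t))_{t\ge0}$ of the infinite walks in the graph, from any initial state. For the input $D(t)\in\mathcal X$ the output is $Q(t)=D(t)$ if $z(t)=0$ and $Q(t)=*$ (erasure) if $z(t)=1$. Let $h_{ch}=\log\lambda$, where $\lambda$ is the Perron eigenvalue (spectral radius) of the $0$–$1$ adjacency matrix of the graph, and let the maximal ratio $\tau$ be the maximum, over all cycles of the graph, of the number of edges labelled $1$ divided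 by the number of edges of the cycle. Let $h_{lin}=\sum_{|\lambda_i|\ge1}\log|\lambda_i|$, summed over the eigenvalues of $A$ with algebraic multiplicity. *Coder-estimators.* A coder-estimator consists of arbitrary maps giving $D(t)=\zeta(t,Y(0),\dots,Y(t))\in\mathcal X$ and $\hat X(t+1)=\eta(t,Q(0),\dots,Q(t))\in\mathbb{R}^n$, with $\hat X(0)=0$. The initial state, the signals $V$, $W$ and the channel noise are mutually unrelated, that is, their joint range is the Cartesian product of their ranges. A coder-estimator yields *uniformly bounded estimation errors* if for any ranges of $V$ and $W$ (sets of sequences) that are bounded uniformly in time there is $l>0$ such that for any range of $X(0)$ contained in the ball $\mathbf B_l=\{x:\|x\|\le l\}$ the supremum of $\|\hat X(t)-X(t)\|$ over all $t\ge0$ and all realizations of initial state, noises and channel noise is finite. **Proposition.** 1. If $h_{lin}+h_{ch}+\tau<1$, then there is a coder-estimator that yields uniformly bounded estimation errors. 2. Conversely, suppose $h_{lin}+\tau>1$. Then for any uniformly bounded ranges of $V$ and of $W$ that contain the zero sequence there are noise sequences $v$ and $w$ in these ranges such that for every coder-estimator and every $l>0$ there are an initial state $x_0\in\mathbf B_l$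 and a channel noise sequence for which the estimation error $\|\hat X(t)-X(t)\|$ is unbounded in $t$. -/

import Mathlib

open scoped Matrix

noncomputable section

/-- A finite-state machine on the state set `S` that governs the erasure noise `v(t) ∈ {0, 1}`
(`true` stands for `1`, an erasure). `edge` is the edge set of the state transition graph, and
`noise s s'` is the noise value on the edge `(s, s')`; its values off the edge set are never used.
Different edges leaving a state carry different noise values, and any state can be reached from
any state by a walk with at least one edge. -/
structure FiniteStateErasureChannel (S : Type*) where
  edge : S → S → Prop
  noise : S → S → Bool
  noise_injective : ∀ s s₁ s₂, edge s s₁ → edge s s₂ → noise s s₁ = noise s s₂ → s₁ = s₂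
  stronglyConnected : ∀ s s', Relation.TransGen edge s s'

namespace FiniteStateErasureChannel

variable {S : Type*}

/-- The range of the channel noise: the label sequences of the infinite walks in the state
transition graph, with an arbitrary initial state. -/
def noiseSequences (ch : FiniteStateErasureChannel S) : Set (ℕ → Bool) :=
  {z | ∃ s : ℕ → S, ∀ t, ch.edge (s t) (s (t + 1)) ∧ z t = ch.noise (s t) (s (t + 1))}

open Classical in
/-- The 0-1 adjacency matrix of the state transition graph. -/
def adjacencyMatrix (ch : FiniteStateErasureChannel S) : Matrix S S ℂ :=
  Matrix.of fun s s' => if ch.edge s s' then 1 else 0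

open Classical in
/-- The topological entropy `log_q λ`, where `λ` is the Perron eigenvalue (the largest modulus of
an eigenvalue) of the adjacency matrix. -/
def topologicalEntropy [Fintype S] (ch : FiniteStateErasureChannel S) (q : ℕ) : ℝ :=
  Real.logb q (spectralRadius ℂ ch.adjacencyMatrix).toReal

/-- `p 0, …, p k` are the distinct vertices of a cycle with `k + 1` edges. The addition is that of
`Fin (k + 1)`, so the successor of `p k` is `p 0`; for `k = 0` the cycle is a loop. -/
def IsCycle (ch : FiniteStateErasureChannel S) {k : ℕ} (p : Fin (k + 1) → S) : Prop :=
  Function.Injective p ∧ ∀ i, ch.edge (p i) (p (i + 1))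

/-- The number of erasure edges of a cycle divided by its number of edges. -/
def cycleRatio (ch : FiniteStateErasureChannel S) {k : ℕ} (p : Fin (k + 1) → S) : ℝ :=
  ((Finset.univ.filter fun i => ch.noise (p i) (p (i + 1)) = true).card : ℝ) / ((k + 1 : ℕ) : ℝ)

/-- The maximal ratio of erasure edges over all cycles. -/
def maximalRatio (ch : FiniteStateErasureChannel S) : ℝ :=
  sSup {r | ∃ (k : ℕ) (p : Fin (k + 1) → S), ch.IsCycle p ∧ r = ch.cycleRatio p}

end FiniteStateErasureChannel

/-- The output of an erasure channel for a given input symbol and noise value; `none` is the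
erasure symbol. -/
def erasureOutput {X : Type*} (x : X) (v : Bool) : Option X :=
  if v = true then none else some x

namespace LTI

variable {n m : ℕ}

/-- The Kalman observability matrix, with the blocks `C, C A, …, C A ^ (n - 1)`. -/
def observabilityMatrix (C : Matrix (Fin m) (Fin n) ℝ) (A : Matrix (Fin n) (Fin n) ℝ) :
    Matrix (Fin n × Fin m) (Fin n) ℝ :=
  Matrix.of fun ki j => (C * A ^ (ki.1 : ℕ)) ki.2 j

/-- The pair `(C, A)` is observable. -/
def Observable (C : Matrix (Fin m) (Fin n) ℝ) (A : Matrix (Fin n) (Fin n) ℝ) : Prop :=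
  (observabilityMatrix C A).rank = n

/-- The complex eigenvalues of `A` with their algebraic multiplicities. -/
def eigenvalues (A : Matrix (Fin n) (Fin n) ℝ) : Multiset ℂ :=
  (A.map (algebraMap ℝ ℂ)).charpoly.roots

/-- The topological entropy of the linear system: the sum of `log_q |λ|` over the eigenvalues `λ`
with `|λ| ≥ 1`. -/
def topologicalEntropy (A : Matrix (Fin n) (Fin n) ℝ) (q : ℕ) : ℝ :=
  (((eigenvalues A).filter fun z => 1 ≤ ‖z‖).map fun z => Real.logb q ‖z‖).sum

/-- `X(0) = x₀`, `X(t + 1) = A X(t) + V(t)`. -/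
def state (A : Matrix (Fin n) (Fin n) ℝ) (x₀ : Fin n → ℝ) (v : ℕ → Fin n → ℝ) :
    ℕ → Fin n → ℝ
  | 0 => x₀
  | t + 1 => A *ᵥ state A x₀ v t + v t

/-- `Y(t) = C X(t) + W(t)`. -/
def output (A : Matrix (Fin n) (Fin n) ℝ) (C : Matrix (Fin m) (Fin n) ℝ) (x₀ : Fin n → ℝ)
    (v : ℕ → Fin n → ℝ) (w : ℕ → Fin m → ℝ) (t : ℕ) : Fin m → ℝ :=
  C *ᵥ state A x₀ v t + w t

/-- A set of signals (the range of a noise signal) that is bounded uniformly in time. -/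
def UniformlyBoundedSignals {k : ℕ} (R : Set (ℕ → Fin k → ℝ)) : Prop :=
  ∃ M : ℝ, ∀ r ∈ R, ∀ t, ‖r t‖ ≤ M

end LTI

/-- A causal coder-estimator: the channel input `D(t) = encode t (Y(0), …, Y(t))`, and the
prediction `X̂(t + 1) = estimate t (Q(0), …, Q(t))` from the channel outputs. -/
structure CoderEstimator (n m : ℕ) (X : Type*) where
  encode : (t : ℕ) → (Fin (t + 1) → Fin m → ℝ) → X
  estimate : (t : ℕ) → (Fin (t + 1) → Option X) → Fin n → ℝ

namespace CoderEstimator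

variable {n m : ℕ} {X : Type*}

/-- The channel output `Q(t)` for the measurement signal `y` and the channel noise `z`. -/
def received (ce : CoderEstimator n m X) (y : ℕ → Fin m → ℝ) (z : ℕ → Bool) (t : ℕ) : Option X :=
  erasureOutput (ce.encode t fun i => y i) (z t)

/-- The state estimate `X̂(t)`, with `X̂(0) = 0`. -/
def stateEstimate (ce : CoderEstimator n m X) (y : ℕ → Fin m → ℝ) (z : ℕ → Bool) :
    ℕ → Fin n → ℝ
  | 0 => 0
  | t + 1 => ce.estimate t fun i => ce.received y z i

/-- The estimation error `X̂(t) - X(t)`, for the initial state `x₀`, the process noise `v`, the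
measurement noise `w` and the channel noise `z`. -/
def estimationError (ce : CoderEstimator n m X) (A : Matrix (Fin n) (Fin n) ℝ)
    (C : Matrix (Fin m) (Fin n) ℝ) (x₀ : Fin n → ℝ) (v : ℕ → Fin n → ℝ) (w : ℕ → Fin m → ℝ)
    (z : ℕ → Bool) (t : ℕ) : Fin n → ℝ :=
  ce.stateEstimate (LTI.output A C x₀ v w) z t - LTI.state A x₀ v t

/-- Uniformly bounded estimation errors: for any uniformly bounded noise ranges `RV`, `RW` there is
`l > 0` such that for any range `RX` of the initial state in the `l`-ball the error is bounded over
all times and all realizations. The initial state, the two noise signals and the channel noise are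
mutually unrelated, so their realizations range independently over `RX`, `RV`, `RW` and
`ch.noiseSequences`. -/
def UniformlyBoundedErrors {S : Type*} (ce : CoderEstimator n m X) (A : Matrix (Fin n) (Fin n) ℝ)
    (C : Matrix (Fin m) (Fin n) ℝ) (ch : FiniteStateErasureChannel S) : Prop :=
  ∀ (RV : Set (ℕ → Fin n → ℝ)) (RW : Set (ℕ → Fin m → ℝ)),
    LTI.UniformlyBoundedSignals RV → LTI.UniformlyBoundedSignals RW →
    ∃ l : ℝ, 0 < l ∧ ∀ RX : Set (Fin n → ℝ), RX ⊆ Metric.closedBall 0 l →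
      ∃ K : ℝ, ∀ x₀ ∈ RX, ∀ v ∈ RV, ∀ w ∈ RW, ∀ z ∈ ch.noiseSequences, ∀ t,
        ‖ce.estimationError A C x₀ v w z t‖ ≤ K

end CoderEstimator

end

/-!
Let `Λ` be the product of the moduli of the unstable eigenvalues of `A`, so that the topological
entropy of the system is `log Λ`.

*Sufficiency.* The noise words of length `T` number about `λ ^ T`, and each has at most `τ T`
erasures up to a constant, because a walk is a union of cycles and a bounded remainder. A maximal
set of words of which no two agree off an erasure pattern (the Gilbert–Varshamov argument) therefore
is an error-free block code with about `q ^ (T (1 - h_ch - τ))` words. For large `T` this exceeds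
the number, about `Λ ^ T`, of small balls that cover the image of the unit ball under `A ^ T`. Hence
in every block the coder can send a quantized state, seen through a deadbeat observer, with a
resolution that makes the scale of the quantizer contract; when a disturbance pushes the state out
of range, the quantizer zooms out by a fixed factor larger than the growth of the system.

*Necessity.* Repeat a cycle of erasure ratio close to `τ` for ever. Up to the time `T` the estimator
has then received about `(1 - τ) T` symbols, so it chooses its estimate among `q ^ ((1 - τ) T)`
points. The initial states whose state at time `T` lies near a given point have volume of the order
`Λ ^ (-T)`: the polynomial `z ^ T g + (1 - g)` in `A`, with `g` equal to `1` at the unstable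
eigenvalues and to `0` at the others, has determinant `± Λ ^ T` and is bounded on these states.
As `q ^ (1 - τ) < Λ`, almost no initial state has bounded estimation errors.
-/

noncomputable section

section Spectrum

open Filter Topology Polynomial

theorem eventually_norm_pow_le_of_spectralRadius_lt {𝔸 : Type*} [NormedRing 𝔸]
    [NormedAlgebra ℂ 𝔸] [CompleteSpace 𝔸] {a : 𝔸} {ρ : ℝ}
    (h : spectralRadius ℂ a < ENNReal.ofReal ρ) : ∀ᶠ T : ℕ in atTop, ‖a ^ T‖ ≤ ρ ^ T := by
  have hρ : 0 < ρ := ENNReal.ofReal_pos.1 (pos_of_gt h)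
  have hgelfand := spectrum.pow_norm_pow_one_div_tendsto_nhds_spectralRadius a
  filter_upwards [hgelfand.eventually_lt_const h, eventually_ge_atTop 1] with T hT hT1
  rw [ENNReal.ofReal_lt_ofReal_iff hρ, one_div] at hT
  exact ((Real.rpow_inv_lt_iff_of_pos (norm_nonneg _) hρ.le (by positivity)).1 hT).le.trans_eq
    (Real.rpow_natCast ρ T)

theorem exists_norm_pow_le_of_spectralRadius_lt_one {𝔸 : Type*} [NormedRing 𝔸]
    [NormedAlgebra ℂ 𝔸] [CompleteSpace 𝔸] {a : 𝔸} (h : spectralRadius ℂ a < 1) :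
    ∃ K, ∀ t : ℕ, ‖a ^ t‖ ≤ K := by
  have hev : ∀ᶠ t : ℕ in atTop, ‖a ^ t‖ ≤ 1 := by
    simpa only [one_pow] using
      eventually_norm_pow_le_of_spectralRadius_lt (h.trans_eq ENNReal.ofReal_one.symm)
  obtain ⟨K, hK⟩ := (isBoundedUnder_of_eventually_le hev).bddAbove_range
  exact ⟨K, fun t => hK ⟨t, rfl⟩⟩

variable {ι K : Type*} [Fintype ι] [DecidableEq ι] [Field K] [IsAlgClosed K]

theorem card_roots_charpoly (A : Matrix ι ι K) : A.charpoly.roots.card = Fintype.card ι := by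
  rw [← (IsAlgClosed.splits _).natDegree_eq_card_roots, A.charpoly_natDegree_eq_dim]

theorem det_sub_algebraMap (A : Matrix ι ι K) (a : K) :
    (A - algebraMap K _ a).det = (A.charpoly.roots.map fun z => z - a).prod := by
  have hchar : A.charpoly.eval a = (A.charpoly.roots.map fun z => a - z).prod :=
    (IsAlgClosed.splits _).eval_eq_prod_roots_of_monic A.charpoly_monic a
  have hscalar : algebraMap K (Matrix ι ι K) a = Matrix.scalar ι a := by
    simp [Matrix.algebraMap_eq_diagonal, Matrix.scalar_apply, Pi.algebraMap_def]
  rw [hscalar, ← neg_sub, Matrix.det_neg, ← A.eval_charpoly, hchar, ← card_roots_charpoly A,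
    ← Multiset.card_map fun z => a - z, ← Multiset.prod_map_neg, Multiset.map_map]
  simp

theorem det_aeval_eq_prod_roots_charpoly (A : Matrix ι ι K) (g : K[X]) :
    (aeval A g).det = (A.charpoly.roots.map fun z => g.eval z).prod := by
  let detAeval : K[X] →* K :=
    Matrix.detMonoidHom.comp (aeval A : K[X] →ₐ[K] Matrix ι ι K).toMonoidHom
  have hdet (p : K[X]) : detAeval p = (aeval A p).det := rfl
  have hg := IsAlgClosed.splits g
  calc (aeval A g).det
      = detAeval (C g.leadingCoeff * (g.roots.map fun a => X - C a).prod) := by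
        rw [← hg.eq_prod_roots, hdet]
    _ = g.leadingCoeff ^ Fintype.card ι *
        (g.roots.map fun a => (A.charpoly.roots.map fun z => z - a).prod).prod := by
        rw [map_mul, map_multiset_prod, Multiset.map_map]
        congr 1
        · simp [hdet, Matrix.algebraMap_eq_diagonal]
        · simp only [Function.comp_def, hdet, map_sub, aeval_X, aeval_C, det_sub_algebraMap]
    _ = (A.charpoly.roots.map fun z => g.eval z).prod := by
        rw [Multiset.prod_map_prod_map, ← card_roots_charpoly A]
        simp only [hg.eval_eq_prod_roots, Multiset.prod_map_mul, Multiset.map_const',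
          Multiset.prod_replicate]

theorem exists_mem_roots_charpoly_of_mem_spectrum {A B : Matrix ι ι K} {g h : K[X]}
    (hB : aeval A h * B = aeval A g) {μ : K} (hμ : μ ∈ spectrum K B) :
    ∃ z ∈ A.charpoly.roots, g.eval z = μ * h.eval z := by
  have hfactor : aeval A (C μ * h - g) = aeval A h * (algebraMap K _ μ - B) := by
    rw [map_sub, map_mul, aeval_C, mul_sub, hB, Algebra.commutes]
  have hdet : (algebraMap K (Matrix ι ι K) μ - B).det = 0 := by
    rwa [spectrum.mem_iff, Matrix.isUnit_iff_isUnit_det, isUnit_iff_ne_zero, not_not] at hμ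
  have hprod : (A.charpoly.roots.map fun z => (C μ * h - g).eval z).prod = 0 := by
    rw [← det_aeval_eq_prod_roots_charpoly, hfactor, Matrix.det_mul, hdet, mul_zero]
  obtain ⟨z, hz, hz0⟩ := Multiset.mem_map.1 (Multiset.prod_eq_zero_iff.1 hprod)
  rw [eval_sub, eval_mul, eval_C, sub_eq_zero] at hz0
  exact ⟨z, hz, hz0.symm⟩

end Spectrum

section RealPolynomial

open Polynomial ComplexConjugate

theorem exists_real_polynomial_aeval_eq (s : Finset ℂ) {r : ℂ → ℂ}
    (hr : ∀ z, r (conj z) = conj (r z)) : ∃ g : ℝ[X], ∀ z ∈ s, aeval z g = r z := by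
  let s' := s ∪ s.image conj
  let G := Lagrange.interpolate s' id r
  have hG {z : ℂ} (hz : z ∈ s') : G.eval z = r z :=
    Lagrange.eval_interpolate_at_node r Function.injective_id.injOn hz
  -- The average of `G` and its conjugate has real coefficients and still interpolates `r`.
  let H := C (1 / 2) * (G + G.map (starRingEnd ℂ))
  obtain ⟨g, hg⟩ : ∃ g : ℝ[X], g.map (algebraMap ℝ ℂ) = H := by
    rw [← mem_lifts, lifts_iff_coeff_lifts]
    intro k
    have hreal : conj (H.coeff k) = H.coeff k := by
      simp only [H, coeff_C_mul, coeff_add, coeff_map, map_mul, map_add, map_div₀, map_one,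
        Complex.conj_ofNat, Complex.conj_conj, add_comm]
    obtain ⟨x, hx⟩ := Complex.conj_eq_iff_real.1 hreal
    exact ⟨x, hx.symm⟩
  refine ⟨g, fun z hz => ?_⟩
  have hconj : (G.map (starRingEnd ℂ)).eval z = r z := by
    have hz' : conj z ∈ s' := Finset.mem_union_right _ (Finset.mem_image_of_mem _ hz)
    calc (G.map (starRingEnd ℂ)).eval z
        = conj (G.eval (conj z)) := by rw [← eval_map_apply, Complex.conj_conj]
      _ = r z := by rw [hG hz', hr, Complex.conj_conj]
  rw [← eval_map_algebraMap, hg, eval_mul, eval_add, eval_C, hconj, hG (Finset.mem_union_left _ hz)]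
  ring

end RealPolynomial

namespace LTI

open Filter Polynomial
open scoped Matrix.Norms.Operator

variable {n : ℕ}

theorem map_aeval (A : Matrix (Fin n) (Fin n) ℝ) (g : ℝ[X]) :
    (aeval A g).map (algebraMap ℝ ℂ)
      = aeval (A.map (algebraMap ℝ ℂ)) (g.map (algebraMap ℝ ℂ)) := by
  rw [aeval_map_algebraMap]
  exact (aeval_algHom_apply (Algebra.ofId ℝ ℂ).mapMatrix A g).symm

theorem abs_det_aeval (A : Matrix (Fin n) (Fin n) ℝ) (g : ℝ[X]) :
    |(aeval A g).det| = ((eigenvalues A).map fun z => ‖aeval z g‖).prod := by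
  have hdet : ((aeval A g).det : ℂ) = ((eigenvalues A).map fun z => aeval z g).prod := by
    have hroots := det_aeval_eq_prod_roots_charpoly (A.map (algebraMap ℝ ℂ))
      (g.map (algebraMap ℝ ℂ))
    rw [← map_aeval] at hroots
    simp only [eval_map_algebraMap] at hroots
    exact (RingHom.map_det (algebraMap ℝ ℂ) _).trans hroots
  rw [← Real.norm_eq_abs, ← Complex.norm_real, hdet]
  exact (map_multiset_prod (normHom : ℂ →*₀ ℝ) _).trans (by rw [Multiset.map_map]; rfl)

/-- The product of the moduli of the eigenvalues outside the open unit disc; its logarithm is the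
topological entropy. -/
def unstableProduct (A : Matrix (Fin n) (Fin n) ℝ) : ℝ :=
  ((eigenvalues A).map fun z => max 1 ‖z‖).prod

theorem one_le_unstableProduct (A : Matrix (Fin n) (Fin n) ℝ) : 1 ≤ unstableProduct A := by
  refine Multiset.one_le_prod fun x hx => ?_
  obtain ⟨z, -, rfl⟩ := Multiset.mem_map.1 hx
  exact le_max_left _ _

theorem topologicalEntropy_eq_logb (A : Matrix (Fin n) (Fin n) ℝ) (q : ℕ) :
    topologicalEntropy A q = Real.logb q (unstableProduct A) := by
  have hne : ∀ x ∈ (eigenvalues A).map fun z => max 1 ‖z‖, x ≠ 0 := by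
    intro x hx
    obtain ⟨z, -, rfl⟩ := Multiset.mem_map.1 hx
    positivity
  simp only [topologicalEntropy, unstableProduct, Real.logb, Real.log_multiset_prod hne,
    Multiset.map_map, Function.comp_apply, ← Multiset.sum_map_div]
  clear hne
  induction eigenvalues A using Multiset.induction_on with
  | empty => simp
  | cons z s ih =>
    rcases le_or_gt 1 ‖z‖ with hz | hz
    · simp [hz, ih]
    · simp [hz.not_ge, hz.le, ih]

theorem exists_polynomial_aeval_eigenvalues (A : Matrix (Fin n) (Fin n) ℝ) :
    ∃ g : ℝ[X], ∀ z ∈ eigenvalues A, aeval z g = if 1 ≤ ‖z‖ then 1 else 0 := by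
  classical
  obtain ⟨g, hg⟩ := exists_real_polynomial_aeval_eq (eigenvalues A).toFinset
    (r := fun z => if 1 ≤ ‖z‖ then 1 else 0) fun z => by
      simp only [RCLike.norm_conj, apply_ite (starRingEnd ℂ), map_one, map_zero]
  exact ⟨g, fun z hz => hg z (Multiset.mem_toFinset.2 hz)⟩

theorem abs_det_aeval_X_pow_mul_add {A : Matrix (Fin n) (Fin n) ℝ} {g : ℝ[X]}
    (hg : ∀ z ∈ eigenvalues A, aeval z g = if 1 ≤ ‖z‖ then 1 else 0) (t : ℕ) :
    |(aeval A (X ^ t * g + (1 - g))).det| = unstableProduct A ^ t := by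
  rw [abs_det_aeval, unstableProduct, ← Multiset.prod_map_pow]
  refine congrArg Multiset.prod (Multiset.map_congr rfl fun z hz => ?_)
  rcases le_or_gt 1 ‖z‖ with h1 | h1
  · simp [hg z hz, h1]
  · simp [hg z hz, h1.not_ge, h1.le]

theorem norm_map_ofReal (B : Matrix (Fin n) (Fin n) ℝ) : ‖B.map (algebraMap ℝ ℂ)‖ = ‖B‖ := by
  simp [Matrix.linfty_opNorm_def]

theorem exists_norm_pow_le_of_norm_aeval_lt {A B : Matrix (Fin n) (Fin n) ℝ} {g h : ℝ[X]}
    (hB : aeval A h * B = aeval A g) (hlt : ∀ z ∈ eigenvalues A, ‖aeval z g‖ < ‖aeval z h‖) :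
    ∃ K, ∀ t : ℕ, ‖B ^ t‖ ≤ K := by
  rcases isEmpty_or_nonempty (Fin n) with hn | hn
  · exact ⟨0, fun t => by rw [Subsingleton.elim (B ^ t) 0, norm_zero]⟩
  let Bc := B.map (algebraMap ℝ ℂ)
  have hBc : aeval (A.map (algebraMap ℝ ℂ)) (h.map (algebraMap ℝ ℂ)) * Bc
      = aeval (A.map (algebraMap ℝ ℂ)) (g.map (algebraMap ℝ ℂ)) := by
    rw [← map_aeval, ← map_aeval, ← hB, Matrix.map_mul]
  have hspec : ∀ μ ∈ spectrum ℂ Bc, ‖μ‖₊ < 1 := by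
    intro μ hμ
    obtain ⟨z, hz, hzμ⟩ := exists_mem_roots_charpoly_of_mem_spectrum hBc hμ
    rw [eval_map_algebraMap, eval_map_algebraMap] at hzμ
    have hμz : ‖μ‖ * ‖aeval z h‖ < ‖aeval z h‖ := by
      rw [← norm_mul, ← hzμ]
      exact hlt z hz
    exact (mul_lt_iff_lt_one_left ((norm_nonneg _).trans_lt (hlt z hz))).1 hμz
  obtain ⟨K, hK⟩ := exists_norm_pow_le_of_spectralRadius_lt_one
    (spectrum.spectralRadius_lt_of_forall_lt Bc hspec)
  refine ⟨K, fun t => ?_⟩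
  rw [← norm_map_ofReal, Matrix.map_pow]
  exact hK t

theorem exists_norm_inv_pow_mul_pow_le {A : Matrix (Fin n) (Fin n) ℝ} {g h : ℝ[X]}
    {Φ : (Matrix (Fin n) (Fin n) ℝ)ˣ} (hΦ : Φ = aeval A h)
    (hlt : ∀ z ∈ eigenvalues A, ‖aeval z g‖ < ‖aeval z h‖) :
    ∃ K, ∀ t : ℕ, ‖(Φ⁻¹).val ^ t * aeval A g ^ t‖ ≤ K := by
  have hcomm : Commute Φ.val (aeval A g) := by
    rw [hΦ]
    exact (Commute.all h g).map (aeval A)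
  have hB : aeval A h * ((Φ⁻¹).val * aeval A g) = aeval A g := by
    rw [← hΦ, Units.mul_inv_cancel_left]
  obtain ⟨K, hK⟩ := exists_norm_pow_le_of_norm_aeval_lt hB hlt
  exact ⟨K, fun t => hcomm.units_inv_left.mul_pow t ▸ hK t⟩

end LTI

section Packing

open MeasureTheory Metric
open scoped NNReal ENNReal

theorem card_mul_measure_ball_le {E : Type*} [NormedAddCommGroup E] [MeasurableSpace E]
    [BorelSpace E] {μ : Measure E} [μ.IsAddHaarMeasure] {s : Finset E} {ε : ℝ≥0} {V : Set E}
    (hs : IsSeparated ε (s : Set E)) (hV : ∀ x ∈ s, ball x (ε / 2) ⊆ V) :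
    s.card * μ (ball 0 (ε / 2)) ≤ μ V := by
  have hdisj : (s : Set E).PairwiseDisjoint fun x => ball x (ε / 2 : ℝ) := by
    intro x hx y hy hxy
    refine ball_disjoint_ball ?_
    have hsep : ε < edist x y := hs hx hy hxy
    rw [edist_nndist, ENNReal.coe_lt_coe, ← NNReal.coe_lt_coe, coe_nndist] at hsep
    linarith
  calc s.card * μ (ball 0 (ε / 2))
      = ∑ x ∈ s, μ (ball x (ε / 2)) := by
        simp only [Measure.addHaar_ball_center, Finset.sum_const, nsmul_eq_mul]
    _ = μ (⋃ x ∈ s, ball x (ε / 2)) :=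
        (measure_biUnion_finset hdisj fun _ _ => measurableSet_ball).symm
    _ ≤ μ V := measure_mono (Set.iUnion₂_subset hV)

theorem exists_finset_cover_of_card_le {E : Type*} [PseudoEMetricSpace E] {ε : ℝ≥0}
    {D : Set E} {N : ℕ}
    (hN : ∀ s : Finset E, (s : Set E) ⊆ D → IsSeparated ε (s : Set E) → s.card ≤ N) :
    ∃ F : Finset E, F.card ≤ N ∧ ∀ x ∈ D, ∃ c ∈ F, edist x c ≤ ε := by
  have hpack : packingNumber ε D ≤ N := by
    refine iSup_le fun s => iSup₂_le fun hsD hs => ?_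
    by_contra! hlt
    obtain ⟨t, hts, ht⟩ := Set.exists_subset_encard_eq (Order.add_one_le_of_lt hlt)
    have htfin : t.Finite := Set.finite_of_encard_eq_coe (k := N + 1) ht
    have hcard := hN htfin.toFinset (by simpa using hts.trans hsD) (by simpa using hs.subset hts)
    rw [htfin.encard_eq_coe_toFinset_card] at ht
    have : htfin.toFinset.card = N + 1 := by exact_mod_cast ht
    omega
  have hcov : coveringNumber ε D ≤ N := (coveringNumber_le_packingNumber ε D).trans hpack
  have hne : coveringNumber ε D ≠ ⊤ := ne_top_of_le_ne_top (ENat.natCast_ne_top N) hcov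
  obtain ⟨F, hF⟩ := finite_minimalCover (ε := ε) (A := D) |>.exists_finset_coe
  have hcover := isCover_minimalCover hne
  have hcard := encard_minimalCover hne
  rw [← hF] at hcover hcard
  refine ⟨F, ?_, hcover⟩
  rw [← hcard, Set.encard_coe_eq_coe_finsetCard] at hcov
  exact_mod_cast hcov

end Packing

namespace LTI

open MeasureTheory Metric Polynomial Topology
open scoped Matrix.Norms.Operator NNReal

variable {n : ℕ}

theorem volume_preimage_mulVec {M : Matrix (Fin n) (Fin n) ℝ} (hM : M.det ≠ 0)
    (V : Set (Fin n → ℝ)) : volume (M.mulVec ⁻¹' V) = ENNReal.ofReal |M.det|⁻¹ * volume V := by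
  have hdet : LinearMap.det M.toLin' = M.det := LinearMap.det_toLin' M
  rw [← abs_inv, ← hdet]
  exact Measure.addHaar_preimage_linearMap volume (f := M.toLin') (by rwa [hdet]) V

-- `Ψ` is the inverse of `h(A)`, where `h(z) = ρ z` for `|z| ≥ 1` and `h(z) = ρ` for `|z| < 1`.
theorem exists_norm_pow_mul_pow_le (A : Matrix (Fin n) (Fin n) ℝ) {ρ : ℝ} (hρ : 1 < ρ) :
    ∃ Ψ : Matrix (Fin n) (Fin n) ℝ, |Ψ.det|⁻¹ = ρ ^ n * unstableProduct A ∧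
      ∃ K, ∀ t : ℕ, ‖Ψ ^ t * A ^ t‖ ≤ K ∧ ‖Ψ ^ t‖ ≤ K := by
  obtain ⟨g, hg⟩ := exists_polynomial_aeval_eigenvalues A
  let h : ℝ[X] := C ρ * (X ^ 1 * g + (1 - g))
  have hdet : |(aeval A h).det| = ρ ^ n * unstableProduct A := by
    rw [map_mul, Matrix.det_mul, abs_mul, abs_det_aeval_X_pow_mul_add hg, pow_one]
    simp [Matrix.algebraMap_eq_diagonal, abs_of_pos (one_pos.trans hρ)]
  have hunit : IsUnit (aeval A h) := by
    rw [Matrix.isUnit_iff_isUnit_det, isUnit_iff_ne_zero, ← abs_pos, hdet]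
    have := one_le_unstableProduct A
    positivity
  have hnorm : ∀ z ∈ eigenvalues A, ‖z‖ < ‖aeval z h‖ ∧ 1 < ‖aeval z h‖ := by
    intro z hz
    have habs : |ρ| = ρ := abs_of_pos (one_pos.trans hρ)
    rcases le_or_gt 1 ‖z‖ with h1 | h1
    · have : ‖aeval z h‖ = ρ * ‖z‖ := by simp [h, hg z hz, h1, habs]
      constructor <;> nlinarith
    · have : ‖aeval z h‖ = ρ := by simp [h, hg z hz, h1.not_ge, habs]
      constructor <;> linarith
  obtain ⟨Φ, hΦ⟩ := hunit
  obtain ⟨K₁, hK₁⟩ := exists_norm_inv_pow_mul_pow_le (g := X) hΦ fun z hz => by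
    simpa using (hnorm z hz).1
  obtain ⟨K₂, hK₂⟩ := exists_norm_inv_pow_mul_pow_le (g := 1) hΦ fun z hz => by
    simpa using (hnorm z hz).2
  have hinv : (Φ⁻¹).val.det * (aeval A h).det = 1 := by
    rw [← hΦ, ← Matrix.det_mul, Units.inv_mul, Matrix.det_one]
  refine ⟨(Φ⁻¹).val, ?_, max K₁ K₂, fun t => ⟨?_, ?_⟩⟩
  · rw [eq_inv_of_mul_eq_one_left hinv, abs_inv, inv_inv, hdet]
  · simpa using (hK₁ t).trans (le_max_left _ _)
  · simpa using (hK₂ t).trans (le_max_right _ _)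

theorem ball_mulVec_subset_preimage {M N : Matrix (Fin n) (Fin n) ℝ} {K δ : ℝ}
    (hMN : ‖M * N‖ ≤ K) (hM : ‖M‖ ≤ K) {x : Fin n → ℝ} (hx : ‖x‖ ≤ 1) :
    ball (N *ᵥ x) δ ⊆ M.mulVec ⁻¹' closedBall 0 (K * (1 + δ)) := by
  intro y hy
  rw [mem_ball_iff_norm] at hy
  have hK0 : 0 ≤ K := (norm_nonneg _).trans hM
  rw [Set.mem_preimage, mem_closedBall_zero_iff]
  calc ‖M *ᵥ y‖ = ‖(M * N) *ᵥ x + M *ᵥ (y - N *ᵥ x)‖ := by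
        rw [← Matrix.mulVec_mulVec, ← Matrix.mulVec_add, add_sub_cancel]
    _ ≤ ‖M * N‖ * ‖x‖ + ‖M‖ * ‖y - N *ᵥ x‖ :=
        (norm_add_le _ _).trans (add_le_add (Matrix.linfty_opNorm_mulVec _ _)
          (Matrix.linfty_opNorm_mulVec _ _))
    _ ≤ K * 1 + K * δ := by gcongr
    _ = K * (1 + δ) := by ring

theorem exists_card_isSeparated_image_pow_le (A : Matrix (Fin n) (Fin n) ℝ) {R : ℝ}
    (hR : unstableProduct A < R) {ε : ℝ≥0} (hε : 0 < ε) :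
    ∃ L : ℝ, ∀ (T : ℕ) (s : Finset (Fin n → ℝ)),
      (s : Set (Fin n → ℝ)) ⊆ (A ^ T).mulVec '' closedBall 0 1 →
      IsSeparated ε (s : Set (Fin n → ℝ)) → s.card ≤ L * R ^ T := by
  have hlim : Filter.Tendsto (fun ρ : ℝ => ρ ^ n * unstableProduct A) (𝓝[>] 1)
      (𝓝 (1 ^ n * unstableProduct A)) :=
    ((continuous_id.pow n).mul_const _).continuousWithinAt
  obtain ⟨ρ, hρR, hρ⟩ := ((hlim.eventually_lt_const (by rwa [one_pow, one_mul])).and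
    eventually_mem_nhdsWithin).exists
  obtain ⟨Ψ, hΨ, K, hK⟩ := exists_norm_pow_mul_pow_le A hρ
  have hR0 : 0 < ρ ^ n * unstableProduct A :=
    mul_pos (pow_pos (one_pos.trans hρ) n) (one_pos.trans_le (one_le_unstableProduct A))
  have hdet : Ψ.det ≠ 0 := by
    intro h
    simp [h, hR0.ne] at hΨ
  let b := volume.real (ball (0 : Fin n → ℝ) (ε / 2))
  let V := closedBall (0 : Fin n → ℝ) (K * (1 + ε / 2))
  have hb : 0 < b := ENNReal.toReal_pos (measure_ball_pos volume 0 (by positivity)).ne'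
    measure_ball_lt_top.ne
  refine ⟨volume.real V / b, fun T s hsD hs => ?_⟩
  have hsub : ∀ y ∈ s, ball y (ε / 2) ⊆ (Ψ ^ T).mulVec ⁻¹' V := by
    intro y hy
    obtain ⟨x, hx, rfl⟩ := hsD hy
    exact ball_mulVec_subset_preimage (hK T).1 (hK T).2 (mem_closedBall_zero_iff.1 hx)
  have hcard := card_mul_measure_ball_le (μ := volume) hs hsub
  rw [volume_preimage_mulVec (by rw [Matrix.det_pow]; exact pow_ne_zero T hdet), Matrix.det_pow,
    abs_pow, ← inv_pow, hΨ] at hcard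
  have hreal : s.card * b ≤ (ρ ^ n * unstableProduct A) ^ T * volume.real V := by
    have := ENNReal.toReal_mono
      (ENNReal.mul_ne_top ENNReal.ofReal_ne_top measure_closedBall_lt_top.ne) hcard
    rwa [ENNReal.toReal_mul, ENNReal.toReal_mul, ENNReal.toReal_natCast,
      ENNReal.toReal_ofReal (by positivity)] at this
  calc (s.card : ℝ)
      ≤ (ρ ^ n * unstableProduct A) ^ T * volume.real V / b := (le_div_iff₀ hb).2 hreal
    _ ≤ R ^ T * volume.real V / b := by gcongr
    _ = volume.real V / b * R ^ T := by ring

theorem exists_finset_cover_image_pow (A : Matrix (Fin n) (Fin n) ℝ) {R : ℝ}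
    (hR : unstableProduct A < R) {ε : ℝ≥0} (hε : 0 < ε) :
    ∃ L : ℝ, ∀ T : ℕ, ∃ F : Finset (Fin n → ℝ), F.card ≤ L * R ^ T ∧
      ∀ x, ‖x‖ ≤ 1 → ∃ c ∈ F, ‖A ^ T *ᵥ x - c‖ ≤ ε := by
  obtain ⟨L, hL⟩ := exists_card_isSeparated_image_pow_le A hR hε
  refine ⟨L, fun T => ?_⟩
  obtain ⟨F, hFcard, hF⟩ := exists_finset_cover_of_card_le (ε := ε)
    (D := (A ^ T).mulVec '' closedBall 0 1) (N := ⌊L * R ^ T⌋₊)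
    fun s hsD hs => Nat.le_floor (hL T s hsD hs)
  have hLR : 0 ≤ L * R ^ T := by simpa using hL T ∅
  refine ⟨F, (Nat.cast_le.2 hFcard).trans (Nat.floor_le hLR), fun x hx => ?_⟩
  obtain ⟨c, hc, hxc⟩ := hF _ ⟨x, mem_closedBall_zero_iff.2 hx, rfl⟩
  refine ⟨c, hc, ?_⟩
  rwa [edist_nndist, ENNReal.coe_le_coe, ← NNReal.coe_le_coe, coe_nndist, dist_eq_norm] at hxc

end LTI

section RemoveWindow

variable {α : Type*} {s : ℕ → α} {i d : ℕ}

/-- The sequence that remains when the `d` terms of `s` from the index `i` on are removed. If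
`s (i + d) = s i`, this cuts a closed part out of the walk `s`. -/
def removeWindow (s : ℕ → α) (i d t : ℕ) : α := if t < i then s t else s (t + d)

theorem removeWindow_of_lt {t : ℕ} (ht : t < i) : removeWindow s i d t = s t := if_pos ht

theorem removeWindow_add (t : ℕ) : removeWindow s i d (i + t) = s (i + d + t) := by
  rw [removeWindow, if_neg (by omega), add_right_comm]

theorem removeWindow_add_one_of_lt (h : s (i + d) = s i) {t : ℕ} (ht : t < i) :
    removeWindow s i d (t + 1) = s (t + 1) := by
  rcases Nat.lt_or_eq_of_le (Nat.succ_le_of_lt ht) with hlt | rfl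
  · exact removeWindow_of_lt hlt
  · exact (removeWindow_add 0).trans h

theorem removeWindow_rel (h : s (i + d) = s i) {r : α → α → Prop} {T : ℕ}
    (hr : ∀ t < i + d + T, r (s t) (s (t + 1))) :
    ∀ t < i + T, r (removeWindow s i d t) (removeWindow s i d (t + 1)) := by
  intro t ht
  rcases lt_or_ge t i with hlt | hle
  · rw [removeWindow_of_lt hlt, removeWindow_add_one_of_lt h hlt]
    exact hr t (by omega)
  · obtain ⟨u, rfl⟩ := Nat.exists_eq_add_of_le hle
    rw [add_assoc i u, removeWindow_add, removeWindow_add]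
    exact hr _ (by omega)

theorem count_eq_count_removeWindow_add (h : s (i + d) = s i) (r : α → α → Prop)
    [DecidableRel r] (T : ℕ) :
    Nat.count (fun t => r (s t) (s (t + 1))) (i + d + T) =
      Nat.count (fun t => r (removeWindow s i d t) (removeWindow s i d (t + 1))) (i + T) +
        Nat.count (fun t => r (s (i + t)) (s (i + (t + 1)))) d := by
  have hhead : Nat.count (fun t => r (removeWindow s i d t) (removeWindow s i d (t + 1))) i =
      Nat.count (fun t => r (s t) (s (t + 1))) i := by
    simp only [Nat.count_eq_card_filter_range]
    congr 1
    refine Finset.filter_congr fun t ht => ?_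
    rw [Finset.mem_range] at ht
    rw [removeWindow_of_lt ht, removeWindow_add_one_of_lt h ht]
  simp only [Nat.count_add, hhead, add_assoc i _ 1, removeWindow_add, add_assoc (i + d)]
  ring

theorem exists_apply_add_succ_eq_injOn_Iio [Fintype α] (s : ℕ → α) :
    ∃ i k, i + (k + 1) ≤ Fintype.card α ∧ s (i + (k + 1)) = s i ∧
      Set.InjOn s (Set.Iio (i + (k + 1))) := by
  classical
  have hex : ∃ j, ∃ i < j, s j = s i := by
    obtain ⟨i, j, hij, h⟩ := Finite.exists_ne_map_eq_of_infinite s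
    rcases hij.lt_or_gt with hlt | hlt
    exacts [⟨j, i, hlt, h.symm⟩, ⟨i, j, hlt, h⟩]
  obtain ⟨i, hij, h⟩ := Nat.find_spec hex
  obtain ⟨k, hk⟩ := Nat.exists_eq_add_of_lt hij
  have hinj : Set.InjOn s (Set.Iio (Nat.find hex)) := by
    intro a ha b hb hab
    by_contra hne
    rcases Ne.lt_or_gt hne with hlt | hlt
    exacts [Nat.find_min hex hb ⟨a, hlt, hab.symm⟩, Nat.find_min hex ha ⟨b, hlt, hab⟩]
  rw [hk, add_assoc] at h hinj
  refine ⟨i, k, ?_, h, hinj⟩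
  rw [← Finset.coe_Iio] at hinj
  simpa using Finset.card_le_card_of_injOn s (t := Finset.univ) (by simp) hinj

end RemoveWindow

namespace FiniteStateErasureChannel

variable {S : Type*} (ch : FiniteStateErasureChannel S)

/-- The number of erasures along the first `T` edges of the walk `s`. -/
def erasures (s : ℕ → S) (T : ℕ) : ℕ :=
  Nat.count (fun t => ch.noise (s t) (s (t + 1)) = true) T

theorem exists_edge (s : S) : ∃ s', ch.edge s s' := by
  obtain ⟨s', h, -⟩ := Relation.TransGen.head'_iff.1 (ch.stronglyConnected s s)
  exact ⟨s', h⟩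

theorem exists_walk (s₀ : S) : ∃ s : ℕ → S, s 0 = s₀ ∧ ∀ t, ch.edge (s t) (s (t + 1)) := by
  choose next hnext using ch.exists_edge
  refine ⟨fun t => next^[t] s₀, rfl, fun t => ?_⟩
  simpa only [Function.iterate_succ_apply'] using hnext _

section Window

variable {ch} {s : ℕ → S} {i k : ℕ}

theorem apply_window_add_one (h : s (i + (k + 1)) = s i) (a : Fin (k + 1)) :
    s (i + (a + 1 : Fin (k + 1))) = s (i + (a + 1)) := by
  rcases eq_or_ne a (Fin.last k) with rfl | ha
  · simpa using h.symm
  · rw [Fin.val_add_one, if_neg ha]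

theorem isCycle_window (hinj : Set.InjOn s (Set.Iio (i + (k + 1))))
    (hs : ∀ t < i + (k + 1), ch.edge (s t) (s (t + 1))) (h : s (i + (k + 1)) = s i) :
    ch.IsCycle fun a : Fin (k + 1) => s (i + a) := by
  refine ⟨fun a b hab => ?_, fun a => ?_⟩
  · have := hinj (Set.mem_Iio.2 (by omega)) (Set.mem_Iio.2 (by omega)) hab
    omega
  · simp only [apply_window_add_one h]
    exact hs (i + a) (by omega)

theorem cycleRatio_window_mul (h : s (i + (k + 1)) = s i) :
    (ch.cycleRatio fun a : Fin (k + 1) => s (i + a)) * (k + 1 : ℕ) =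
      ch.erasures (fun t => s (i + t)) (k + 1) := by
  rw [cycleRatio, div_mul_cancel₀ _ (by positivity), erasures, Nat.count_eq_card_filter_range,
    Finset.card_filter, Finset.card_filter, Finset.sum_range]
  simp only [apply_window_add_one h]

end Window

theorem cycleRatio_nonneg {k : ℕ} (p : Fin (k + 1) → S) : 0 ≤ ch.cycleRatio p := by
  unfold cycleRatio
  positivity

theorem cycleRatio_le_one {k : ℕ} (p : Fin (k + 1) → S) : ch.cycleRatio p ≤ 1 := by
  rw [cycleRatio, div_le_one (by positivity)]
  exact_mod_cast (Finset.card_le_univ _).trans_eq (Fintype.card_fin _)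

variable {ch} in
theorem IsCycle.cycleRatio_le_maximalRatio {k : ℕ} {p : Fin (k + 1) → S} (hp : ch.IsCycle p) :
    ch.cycleRatio p ≤ ch.maximalRatio := by
  refine le_csSup ⟨1, ?_⟩ ⟨k, p, hp, rfl⟩
  rintro _ ⟨_, p, -, rfl⟩
  exact ch.cycleRatio_le_one p

theorem maximalRatio_nonneg : 0 ≤ ch.maximalRatio := by
  refine Real.sSup_nonneg ?_
  rintro _ ⟨_, p, -, rfl⟩
  exact ch.cycleRatio_nonneg p

theorem exists_isCycle [Finite S] [Nonempty S] : ∃ (k : ℕ) (p : Fin (k + 1) → S), ch.IsCycle p := by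
  have := Fintype.ofFinite S
  obtain ⟨s, -, hs⟩ := ch.exists_walk (Classical.arbitrary S)
  obtain ⟨i, k, -, h, hinj⟩ := exists_apply_add_succ_eq_injOn_Iio s
  exact ⟨k, _, isCycle_window hinj (fun t _ => hs t) h⟩

-- Cutting a cycle out of the walk removes at most `maximalRatio` erasures per edge, and fewer than
-- `Fintype.card S` edges are left when no cycle remains.
theorem erasures_le [Fintype S] {T : ℕ} {s : ℕ → S} (hs : ∀ t < T, ch.edge (s t) (s (t + 1))) :
    ch.erasures s T ≤ ch.maximalRatio * T + Fintype.card S := by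
  induction T using Nat.strong_induction_on generalizing s with
  | _ T ih =>
    rcases lt_or_ge T (Fintype.card S) with hT | hT
    · have hcount : (ch.erasures s T : ℝ) ≤ Fintype.card S := by
        exact_mod_cast (Nat.count_le ..).trans hT.le
      have := mul_nonneg ch.maximalRatio_nonneg T.cast_nonneg
      linarith
    · obtain ⟨i, k, hcard, h, hinj⟩ := exists_apply_add_succ_eq_injOn_Iio s
      obtain ⟨r, rfl⟩ := Nat.exists_eq_add_of_le (hcard.trans hT)
      have hcycle := isCycle_window hinj (fun t ht => hs t (by omega)) h
      have hcut := ih (i + r) (by omega) (removeWindow_rel h hs)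
      have hratio := mul_le_mul_of_nonneg_right hcycle.cycleRatio_le_maximalRatio
        (k + 1 : ℕ).cast_nonneg
      rw [cycleRatio_window_mul h] at hratio
      have hsplit : ch.erasures s (i + (k + 1) + r) =
          ch.erasures (removeWindow s i (k + 1)) (i + r) +
            ch.erasures (fun t => s (i + t)) (k + 1) :=
        count_eq_count_removeWindow_add h (fun a b => ch.noise a b = true) r
      rw [hsplit]
      push_cast at hratio hcut ⊢
      linarith

end FiniteStateErasureChannel

section ZeroErrorCodes

theorem exists_finset_pairwise_not_card_le {α : Type*} [Fintype α] {r : α → α → Prop}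
    [DecidableRel r] (hrefl : ∀ a, r a a) (hsymm : ∀ a b, r a b → r b a) {N : ℕ}
    (hN : ∀ a, (Finset.univ.filter (r a)).card ≤ N) :
    ∃ s : Finset α, (s : Set α).Pairwise (fun a b => ¬r a b) ∧ Fintype.card α ≤ s.card * N := by
  classical
  obtain ⟨s, hs⟩ := Set.Finite.exists_maximal
    (Set.toFinite {s : Finset α | (s : Set α).Pairwise fun a b => ¬r a b}) ⟨∅, by simp⟩
  have hcover : Finset.univ ⊆ s.biUnion fun a => Finset.univ.filter (r a) := by
    intro b _
    by_contra hb
    simp only [Finset.mem_biUnion, Finset.mem_filter_univ, not_exists, not_and] at hb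
    have hins : (insert b s : Finset α) ≤ s := by
      refine hs.2 ?_ (Finset.subset_insert b s)
      simp only [Set.mem_ofPred_eq, Finset.coe_insert]
      exact hs.1.insert fun a ha _ => ⟨fun h => hb a ha (hsymm b a h), hb a ha⟩
    exact hb b (hins (Finset.mem_insert_self b s)) (hrefl b)
  refine ⟨s, hs.1, ?_⟩
  calc Fintype.card α = Finset.univ.card := Finset.card_univ.symm
    _ ≤ (s.biUnion fun a => Finset.univ.filter (r a)).card := Finset.card_le_card hcover
    _ ≤ s.card * N := Finset.card_biUnion_le_card_mul _ _ _ fun a _ => hN a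

variable {X : Type*} {T : ℕ}

/-- A code that corrects the erasure patterns in `W`: a codeword is determined by its letters at
the positions that are not erased (those `i` with `u i = false`). -/
def IsZeroErrorCode (W : Finset (Fin T → Bool)) (code : Finset (Fin T → X)) : Prop :=
  ∀ u ∈ W, ∀ c ∈ code, ∀ c' ∈ code, (∀ i, u i = false → c i = c' i) → c = c'

theorem card_agree_off_erased [Fintype X] [DecidableEq X] (u : Fin T → Bool) (c : Fin T → X) :
    (Finset.univ.filter fun c' : Fin T → X => ∀ i, u i = false → c i = c' i).card =
      Fintype.card X ^ (Finset.univ.filter fun i => u i = true).card := by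
  have hpi : (Finset.univ.filter fun c' : Fin T → X => ∀ i, u i = false → c i = c' i) =
      Fintype.piFinset fun i => if u i = true then Finset.univ else {c i} := by
    ext c'
    simp only [Finset.mem_filter_univ, Fintype.mem_piFinset]
    refine forall_congr' fun i => ?_
    cases u i <;> simp [eq_comm]
  simp only [hpi, Fintype.card_piFinset, apply_ite Finset.card, Finset.card_univ,
    Finset.card_singleton, Finset.prod_ite, Finset.prod_const, one_pow, mul_one]

theorem exists_isZeroErrorCode [Fintype X] {W : Finset (Fin T → Bool)} (hW : W.Nonempty) :
    ∃ code : Finset (Fin T → X), IsZeroErrorCode W code ∧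
      Fintype.card X ^ T ≤
        code.card * ∑ u ∈ W, Fintype.card X ^ (Finset.univ.filter fun i => u i = true).card := by
  classical
  let r (c c' : Fin T → X) : Prop := ∃ u ∈ W, ∀ i, u i = false → c i = c' i
  have hcard (c : Fin T → X) : (Finset.univ.filter (r c)).card ≤
      ∑ u ∈ W, Fintype.card X ^ (Finset.univ.filter fun i => u i = true).card := by
    simp only [← card_agree_off_erased _ c]
    refine le_trans (Finset.card_le_card fun c' hc' => ?_) Finset.card_biUnion_le
    simpa [r] using hc'
  obtain ⟨code, hcode, hle⟩ := exists_finset_pairwise_not_card_le (r := r)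
    (fun _ => hW.imp fun _ hu => ⟨hu, fun _ _ => rfl⟩)
    (fun _ _ => fun ⟨u, hu, h⟩ => ⟨u, hu, fun i hi => (h i hi).symm⟩) hcard
  refine ⟨code, fun u hu c hc c' hc' h => ?_, by simpa using hle⟩
  by_contra hne
  exact hcode hc hc' hne ⟨u, hu, h⟩

theorem IsZeroErrorCode.exists_decoder {W : Finset (Fin T → Bool)} {code : Finset (Fin T → X)}
    (hcode : IsZeroErrorCode W code) {M : Type*} [Fintype M] [Nonempty M]
    (hM : Fintype.card M ≤ code.card) :
    ∃ (enc : M → Fin T → X) (dec : (Fin T → Option X) → M),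
      ∀ u ∈ W, ∀ a, dec (fun i => erasureOutput (enc a i) (u i)) = a := by
  classical
  obtain ⟨enc⟩ : Nonempty (M ↪ code) :=
    Function.Embedding.nonempty_of_card_le (by rwa [Fintype.card_coe])
  let out (p : M × W) (i : Fin T) : Option X := erasureOutput ((enc p.1).val i) (p.2.val i)
  have hout : (Prod.fst : M × W → M).FactorsThrough out := by
    intro p p' h
    refine enc.injective (Subtype.ext
      (hcode _ p.2.2 _ (enc p.1).2 _ (enc p'.1).2 fun i hi => ?_))
    have hi' := congrFun h i
    cases hp' : p'.2.val i <;> simp_all [out, erasureOutput]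
  exact ⟨fun a => enc a, Function.extend out Prod.fst fun _ => Classical.arbitrary M,
    fun u hu a => hout.extend_apply _ (a, ⟨u, hu⟩)⟩

end ZeroErrorCodes

namespace FiniteStateErasureChannel

open Filter Topology
open scoped Matrix.Norms.Operator

variable {S : Type*} (ch : FiniteStateErasureChannel S)

open Classical in
/-- The label words of length `T` of the infinite walks that start in the state `s`. -/
def noiseWordsFrom (T : ℕ) (s : S) : Finset (Fin T → Bool) :=
  Finset.univ.filter fun u => ∃ p : ℕ → S, p 0 = s ∧ (∀ t, ch.edge (p t) (p (t + 1))) ∧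
    ∀ i, u i = ch.noise (p i) (p (i + 1))

variable {ch} in
theorem mem_noiseWordsFrom {T : ℕ} {s : S} {u : Fin T → Bool} :
    u ∈ ch.noiseWordsFrom T s ↔ ∃ p : ℕ → S, p 0 = s ∧ (∀ t, ch.edge (p t) (p (t + 1))) ∧
      ∀ i, u i = ch.noise (p i) (p (i + 1)) := by
  simp [noiseWordsFrom]

theorem noiseWordsFrom_nonempty (T : ℕ) (s : S) : (ch.noiseWordsFrom T s).Nonempty := by
  obtain ⟨p, hp0, hp⟩ := ch.exists_walk s
  exact ⟨_, mem_noiseWordsFrom.2 ⟨p, hp0, hp, fun _ => rfl⟩⟩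

variable [Fintype S]

/-- The words of length `T` that occur in the channel noise. -/
def noiseWords (T : ℕ) : Finset (Fin T → Bool) :=
  open Classical in Finset.univ.biUnion (ch.noiseWordsFrom T)

variable {ch} in
theorem restrict_mem_noiseWords {z : ℕ → Bool} (hz : z ∈ ch.noiseSequences) (t₀ T : ℕ) :
    (fun i : Fin T => z (t₀ + i)) ∈ ch.noiseWords T := by
  obtain ⟨s, hs⟩ := hz
  exact Finset.mem_biUnion.2 ⟨s t₀, Finset.mem_univ _, mem_noiseWordsFrom.2
    ⟨fun t => s (t₀ + t), rfl, fun t => (hs _).1, fun i => (hs _).2⟩⟩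

theorem noiseWords_nonempty [Nonempty S] (T : ℕ) : (ch.noiseWords T).Nonempty :=
  Finset.biUnion_nonempty.2
    ⟨Classical.arbitrary S, Finset.mem_univ _, ch.noiseWordsFrom_nonempty T _⟩

variable {ch} in
theorem card_erased_le {T : ℕ} {u : Fin T → Bool} (hu : u ∈ ch.noiseWords T) :
    (Finset.univ.filter fun i => u i = true).card ≤ ch.maximalRatio * T + Fintype.card S := by
  obtain ⟨s, -, hs⟩ := Finset.mem_biUnion.1 hu
  obtain ⟨p, -, hp, hu⟩ := mem_noiseWordsFrom.1 hs
  refine le_of_eq_of_le ?_ (ch.erasures_le fun t _ => hp t)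
  simp only [erasures, Nat.count_eq_card_filter_range, Finset.card_filter, Finset.sum_range, hu]

open Classical in
theorem card_noiseWordsFrom_succ_le (T : ℕ) (s : S) :
    (ch.noiseWordsFrom (T + 1) s).card ≤
      ∑ s' ∈ Finset.univ.filter (ch.edge s), (ch.noiseWordsFrom T s').card := by
  have hsub : ch.noiseWordsFrom (T + 1) s ⊆ (Finset.univ.filter (ch.edge s)).biUnion fun s' =>
      (ch.noiseWordsFrom T s').image fun u => Fin.cons (ch.noise s s') u := by
    intro u hu
    obtain ⟨p, rfl, hp, hu⟩ := mem_noiseWordsFrom.1 hu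
    refine Finset.mem_biUnion.2 ⟨p 1, Finset.mem_filter_univ _ |>.2 (hp 0),
      Finset.mem_image.2 ⟨Fin.tail u, mem_noiseWordsFrom.2
        ⟨fun t => p (t + 1), rfl, fun t => hp (t + 1), fun i => hu i.succ⟩, ?_⟩⟩
    rw [← Fin.cons_self_tail u]
    exact congrArg₂ _ (hu 0).symm rfl
  calc (ch.noiseWordsFrom (T + 1) s).card
      ≤ _ := Finset.card_le_card hsub
    _ ≤ _ := Finset.card_biUnion_le
    _ ≤ _ := Finset.sum_le_sum fun s' _ => Finset.card_image_le

open Classical in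
theorem card_noiseWordsFrom_le_re (T : ℕ) (s : S) :
    (ch.noiseWordsFrom T s).card ≤ ((ch.adjacencyMatrix ^ T *ᵥ 1) s).re := by
  induction T generalizing s with
  | zero => simpa using Finset.card_le_univ (ch.noiseWordsFrom 0 s)
  | succ T ih =>
    calc ((ch.noiseWordsFrom (T + 1) s).card : ℝ)
        ≤ ∑ s' ∈ Finset.univ.filter (ch.edge s), ((ch.noiseWordsFrom T s').card : ℝ) := by
          exact_mod_cast ch.card_noiseWordsFrom_succ_le T s
      _ ≤ ∑ s' ∈ Finset.univ.filter (ch.edge s), ((ch.adjacencyMatrix ^ T *ᵥ 1) s').re :=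
          Finset.sum_le_sum fun s' _ => ih s'
      _ = ((ch.adjacencyMatrix ^ (T + 1) *ᵥ 1) s).re := by
          rw [pow_succ', ← Matrix.mulVec_mulVec, Matrix.mulVec, dotProduct, Complex.re_sum,
            Finset.sum_filter]
          refine Finset.sum_congr rfl fun s' _ => ?_
          by_cases h : ch.edge s s' <;> simp [adjacencyMatrix, h]

open Classical in
theorem card_noiseWordsFrom_le_norm (T : ℕ) (s : S) :
    (ch.noiseWordsFrom T s).card ≤ ‖ch.adjacencyMatrix ^ T‖ := by
  have : Nonempty S := ⟨s⟩
  calc ((ch.noiseWordsFrom T s).card : ℝ)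
      ≤ ((ch.adjacencyMatrix ^ T *ᵥ 1) s).re := ch.card_noiseWordsFrom_le_re T s
    _ ≤ ‖(ch.adjacencyMatrix ^ T *ᵥ 1) s‖ := Complex.re_le_norm _
    _ ≤ ‖ch.adjacencyMatrix ^ T *ᵥ 1‖ := norm_le_pi_norm _ s
    _ ≤ ‖ch.adjacencyMatrix ^ T‖ * ‖(1 : S → ℂ)‖ := Matrix.linfty_opNorm_mulVec _ _
    _ = ‖ch.adjacencyMatrix ^ T‖ := by rw [norm_one, mul_one]

open Classical in
/-- The largest modulus of an eigenvalue of the adjacency matrix. -/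
def perronEigenvalue : ℝ := (spectralRadius ℂ ch.adjacencyMatrix).toReal

open Classical in
theorem eventually_norm_adjacencyMatrix_pow_le [Nonempty S] {ρ : ℝ}
    (hρ : ch.perronEigenvalue < ρ) : ∀ᶠ T in atTop, ‖ch.adjacencyMatrix ^ T‖ ≤ ρ ^ T :=
  eventually_norm_pow_le_of_spectralRadius_lt <| (ENNReal.lt_ofReal_iff_toReal_lt
    ((spectrum.spectralRadius_le_nnnorm _).trans_lt ENNReal.coe_lt_top).ne).2 hρ

theorem one_le_perronEigenvalue [Nonempty S] : 1 ≤ ch.perronEigenvalue := by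
  classical
  by_contra! hlt
  obtain ⟨ρ, hρ, hρ1⟩ := exists_between hlt
  obtain ⟨T, hT, hT0⟩ :=
    ((ch.eventually_norm_adjacencyMatrix_pow_le hρ).and (eventually_gt_atTop 0)).exists
  have hone : (1 : ℝ) ≤ ρ ^ T := by
    refine le_trans ?_ ((ch.card_noiseWordsFrom_le_norm T (Classical.arbitrary S)).trans hT)
    exact_mod_cast (ch.noiseWordsFrom_nonempty T _).card_pos
  exact hone.not_gt (pow_lt_one₀ (ENNReal.toReal_nonneg.trans hρ.le) hρ1 hT0.ne')

theorem eventually_card_noiseWords_le [Nonempty S] {ρ : ℝ} (hρ : ch.perronEigenvalue < ρ) :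
    ∀ᶠ T in atTop, (ch.noiseWords T).card ≤ Fintype.card S * ρ ^ T := by
  classical
  filter_upwards [ch.eventually_norm_adjacencyMatrix_pow_le hρ] with T hT
  calc ((ch.noiseWords T).card : ℝ)
      ≤ ∑ s, ((ch.noiseWordsFrom T s).card : ℝ) := by exact_mod_cast Finset.card_biUnion_le
    _ ≤ ∑ _s : S, ρ ^ T :=
        Finset.sum_le_sum fun s _ => (ch.card_noiseWordsFrom_le_norm T s).trans hT
    _ = Fintype.card S * ρ ^ T := by rw [Finset.sum_const, nsmul_eq_mul, Finset.card_univ]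

theorem sum_pow_card_erased_le {q : ℝ} (hq : 1 ≤ q) (T : ℕ) :
    ∑ u ∈ ch.noiseWords T, q ^ (Finset.univ.filter fun i => u i = true).card ≤
      (ch.noiseWords T).card * ((q ^ ch.maximalRatio) ^ T * q ^ Fintype.card S) := by
  have hq0 : 0 < q := one_pos.trans_le hq
  rw [← nsmul_eq_mul]
  refine Finset.sum_le_card_nsmul _ _ _ fun u hu => ?_
  calc q ^ (Finset.univ.filter fun i => u i = true).card
      = q ^ ((Finset.univ.filter fun i => u i = true).card : ℝ) := (Real.rpow_natCast _ _).symm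
    _ ≤ q ^ (ch.maximalRatio * T + Fintype.card S) :=
        Real.rpow_le_rpow_of_exponent_le hq (card_erased_le hu)
    _ = (q ^ ch.maximalRatio) ^ T * q ^ Fintype.card S := by
        rw [Real.rpow_add hq0, Real.rpow_mul hq0.le, Real.rpow_natCast, Real.rpow_natCast]

theorem eventually_exists_isZeroErrorCode [Nonempty S] {X : Type*} [Fintype X] {R : ℝ}
    (hR : 0 < R)
    (h : R * ch.perronEigenvalue * (Fintype.card X : ℝ) ^ ch.maximalRatio < Fintype.card X) :
    ∀ᶠ T in atTop, ∃ code : Finset (Fin T → X),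
      IsZeroErrorCode (ch.noiseWords T) code ∧ R ^ T ≤ code.card := by
  set q : ℝ := (Fintype.card X : ℝ)
  have hperron : 0 < ch.perronEigenvalue := one_pos.trans_le ch.one_le_perronEigenvalue
  have hq0 : 0 < q := lt_of_le_of_lt (by positivity) h
  have hq1 : 1 ≤ q := Nat.one_le_cast.2 (Nat.cast_pos.1 hq0)
  have hqτ : 0 < q ^ ch.maximalRatio := Real.rpow_pos_of_pos hq0 _
  obtain ⟨ρ, hρ, hρq⟩ : ∃ ρ, ch.perronEigenvalue < ρ ∧ R * ρ * q ^ ch.maximalRatio < q := by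
    have hlim : Tendsto (fun ρ => R * ρ * q ^ ch.maximalRatio) (𝓝[>] ch.perronEigenvalue)
        (𝓝 (R * ch.perronEigenvalue * q ^ ch.maximalRatio)) :=
      ((continuous_const.mul continuous_id).mul_const _).continuousWithinAt
    exact (eventually_mem_nhdsWithin.and (hlim.eventually_lt_const h)).exists
  have hρ0 : 0 < ρ := hperron.trans hρ
  have hgrow := (isLittleO_pow_pow_of_lt_left (by positivity) hρq).def
    (c := (Fintype.card S * q ^ Fintype.card S)⁻¹) (by positivity)
  filter_upwards [ch.eventually_card_noiseWords_le hρ, hgrow] with T hwords hT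
  obtain ⟨code, hcode, hcard⟩ := exists_isZeroErrorCode (X := X) (ch.noiseWords_nonempty T)
  refine ⟨code, hcode, ?_⟩
  let D : ℝ := Fintype.card S * ρ ^ T * ((q ^ ch.maximalRatio) ^ T * q ^ Fintype.card S)
  refine le_of_mul_le_mul_right ?_ (show 0 < D by positivity)
  calc R ^ T * D
      = (Fintype.card S * q ^ Fintype.card S) * ‖(R * ρ * q ^ ch.maximalRatio) ^ T‖ := by
        rw [Real.norm_of_nonneg (by positivity), mul_pow, mul_pow]
        ring
    _ ≤ ‖q ^ T‖ := by rwa [inv_mul_eq_div, le_div_iff₀' (by positivity)] at hT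
    _ = q ^ T := Real.norm_of_nonneg (by positivity)
    _ ≤ code.card * ∑ u ∈ ch.noiseWords T, q ^ (Finset.univ.filter fun i => u i = true).card := by
        simp only [q]
        exact_mod_cast hcard
    _ ≤ code.card * D := by
        gcongr
        exact (ch.sum_pow_card_erased_le hq1 T).trans
          (mul_le_mul_of_nonneg_right hwords (by positivity))

end FiniteStateErasureChannel

namespace LTI

open scoped Matrix.Norms.Operator

variable {n m : ℕ} {A : Matrix (Fin n) (Fin n) ℝ} {C : Matrix (Fin m) (Fin n) ℝ}
  {v : ℕ → Fin n → ℝ} {w : ℕ → Fin m → ℝ} {M : ℝ}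

theorem state_add (x₀ : Fin n → ℝ) (s t : ℕ) :
    state A x₀ v (s + t) = A ^ t *ᵥ state A x₀ v s + state A 0 (fun i => v (s + i)) t := by
  induction t with
  | zero => simp [state]
  | succ t ih =>
    rw [← add_assoc, state, ih, state, Matrix.mulVec_add, Matrix.mulVec_mulVec, pow_succ',
      add_assoc]

theorem state_eq_pow_mulVec_add (x₀ : Fin n → ℝ) (t : ℕ) :
    state A x₀ v t = A ^ t *ᵥ x₀ + state A 0 v t := by
  simpa [state] using state_add (A := A) (v := v) x₀ 0 t

theorem output_add (x₀ : Fin n → ℝ) (s t : ℕ) :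
    output A C x₀ v w (s + t) = C *ᵥ (A ^ t *ᵥ state A x₀ v s) +
      output A C 0 (fun i => v (s + i)) (fun i => w (s + i)) t := by
  rw [output, output, state_add, Matrix.mulVec_add, add_assoc]

theorem norm_state_zero_le (hv : ∀ t, ‖v t‖ ≤ M) (t : ℕ) :
    ‖state A 0 v t‖ ≤ M * ∑ i ∈ Finset.range t, ‖A‖ ^ i := by
  induction t with
  | zero => simp [state]
  | succ t ih =>
    calc ‖A *ᵥ state A 0 v t + v t‖
        ≤ ‖A‖ * (M * ∑ i ∈ Finset.range t, ‖A‖ ^ i) + M :=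
          norm_add_le_of_le ((Matrix.linfty_opNorm_mulVec _ _).trans (by gcongr)) (hv t)
      _ = M * ∑ i ∈ Finset.range (t + 1), ‖A‖ ^ i := by rw [geom_sum_succ]; ring

theorem norm_state_zero_le_of_le (hv : ∀ t, ‖v t‖ ≤ M) {t T : ℕ} (htT : t ≤ T) :
    ‖state A 0 v t‖ ≤ M * ∑ i ∈ Finset.range T, ‖A‖ ^ i := by
  have hM : 0 ≤ M := (norm_nonneg _).trans (hv 0)
  refine (norm_state_zero_le hv t).trans ?_
  gcongr

theorem observabilityMatrix_mulVec (x : Fin n → ℝ) (ij : Fin n × Fin m) :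
    (observabilityMatrix C A *ᵥ x) ij = (C *ᵥ (A ^ (ij.1 : ℕ) *ᵥ x)) ij.2 := by
  rw [Matrix.mulVec_mulVec]
  rfl

theorem Observable.exists_leftInverse (h : Observable C A) :
    ∃ L : Matrix (Fin n) (Fin n × Fin m) ℝ, L * observabilityMatrix C A = 1 := by
  have hker : LinearMap.ker (observabilityMatrix C A).mulVecLin = ⊥ := by
    have hrank : Module.finrank ℝ (LinearMap.range (observabilityMatrix C A).mulVecLin) = n := h
    have hnullity := LinearMap.finrank_range_add_finrank_ker (observabilityMatrix C A).mulVecLin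
    rw [hrank, Module.finrank_fin_fun] at hnullity
    exact Submodule.finrank_eq_zero.1 (by omega)
  obtain ⟨L, hL⟩ := LinearMap.exists_leftInverse_of_injective _ hker
  refine ⟨L.toMatrix', ?_⟩
  rw [← LinearMap.toMatrix'_id, ← hL, LinearMap.toMatrix'_comp, ← Matrix.toLin'_apply',
    LinearMap.toMatrix'_toLin']

/-- A deadbeat observer working in blocks of length `T`: an estimate of the state at the times
`k * T` computed from the outputs `y` at earlier times, where `L` is a left inverse of the
observability matrix. -/
def blockObserver (A : Matrix (Fin n) (Fin n) ℝ) (L : Matrix (Fin n) (Fin n × Fin m) ℝ) (T : ℕ)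
    (y : ℕ → Fin m → ℝ) : ℕ → Fin n → ℝ
  | 0 => 0
  | k + 1 => A ^ T *ᵥ (L *ᵥ fun ij => y (k * T + ij.1) ij.2)

variable {L : Matrix (Fin n) (Fin n × Fin m) ℝ} {T : ℕ}

theorem blockObserver_congr (hT : n ≤ T) {y y' : ℕ → Fin m → ℝ} {k : ℕ}
    (h : ∀ t < k * T, y t = y' t) : blockObserver A L T y k = blockObserver A L T y' k := by
  cases k with
  | zero => rfl
  | succ k =>
    have hblock (i : Fin n) : k * T + i < (k + 1) * T := by rw [Nat.succ_mul]; omega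
    simp only [blockObserver, h _ (hblock _)]

theorem blockObserver_succ_sub_state (hL : L * observabilityMatrix C A = 1) (x₀ : Fin n → ℝ)
    (k : ℕ) :
    blockObserver A L T (output A C x₀ v w) (k + 1) - state A x₀ v ((k + 1) * T) =
      blockObserver A L T
          (output A C 0 (fun i => v (k * T + i)) fun i => w (k * T + i)) 1 -
        state A 0 (fun i => v (k * T + i)) T := by
  have hblock : (fun ij : Fin n × Fin m => output A C x₀ v w (k * T + ij.1) ij.2) =
      observabilityMatrix C A *ᵥ state A x₀ v (k * T) + fun ij =>
        output A C 0 (fun i => v (k * T + i)) (fun i => w (k * T + i)) (0 * T + ij.1) ij.2 := by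
    ext ij
    rw [output_add, Pi.add_apply, Pi.add_apply, observabilityMatrix_mulVec, Nat.zero_mul,
      Nat.zero_add]
  rw [blockObserver, blockObserver, hblock, Matrix.mulVec_add, Matrix.mulVec_mulVec, hL,
    Matrix.one_mulVec, Matrix.mulVec_add, Nat.succ_mul, state_add]
  abel

theorem norm_output_zero_le (hv : ∀ t, ‖v t‖ ≤ M) (hw : ∀ t, ‖w t‖ ≤ M) {t : ℕ} (htT : t ≤ T) :
    ‖output A C 0 v w t‖ ≤ ‖C‖ * (M * ∑ i ∈ Finset.range T, ‖A‖ ^ i) + M :=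
  norm_add_le_of_le ((Matrix.linfty_opNorm_mulVec _ _).trans
    (mul_le_mul_of_nonneg_left (norm_state_zero_le_of_le hv htT) (norm_nonneg _))) (hw t)

theorem norm_blockObserver_one_le {y : ℕ → Fin m → ℝ} {c : ℝ} (hc : 0 ≤ c) (hT : n ≤ T)
    (hy : ∀ t ≤ T, ‖y t‖ ≤ c) : ‖blockObserver A L T y 1‖ ≤ ‖A ^ T‖ * (‖L‖ * c) := by
  have hblock : ‖fun ij : Fin n × Fin m => y (0 * T + ij.1) ij.2‖ ≤ c :=
    (pi_norm_le_iff_of_nonneg hc).2 fun ij =>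
      (norm_le_pi_norm _ ij.2).trans (hy _ (by omega))
  refine (Matrix.linfty_opNorm_mulVec _ _).trans ?_
  gcongr
  exact (Matrix.linfty_opNorm_mulVec _ _).trans (by gcongr)

theorem exists_norm_blockObserver_sub_state_le (hL : L * observabilityMatrix C A = 1) (hT : n ≤ T)
    (M : ℝ) :
    ∃ K : ℝ, ∀ (x₀ : Fin n → ℝ) (v : ℕ → Fin n → ℝ) (w : ℕ → Fin m → ℝ), ‖x₀‖ ≤ M →
      (∀ t, ‖v t‖ ≤ M) → (∀ t, ‖w t‖ ≤ M) →
      ∀ k, ‖blockObserver A L T (output A C x₀ v w) k - state A x₀ v (k * T)‖ ≤ K := by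
  let D := M * ∑ i ∈ Finset.range T, ‖A‖ ^ i
  refine ⟨max M (‖A ^ T‖ * (‖L‖ * (‖C‖ * D + M)) + D), fun x₀ v w hx₀ hv hw k => ?_⟩
  have hM : 0 ≤ M := (norm_nonneg _).trans hx₀
  cases k with
  | zero =>
    rw [blockObserver, zero_sub, norm_neg, Nat.zero_mul]
    exact hx₀.trans (le_max_left _ _)
  | succ k =>
    rw [blockObserver_succ_sub_state hL]
    refine le_max_of_le_right (norm_sub_le_of_le ?_
      (norm_state_zero_le_of_le (fun _ => hv _) le_rfl))
    exact norm_blockObserver_one_le (by positivity) hT fun t ht =>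
      norm_output_zero_le (fun _ => hv _) (fun _ => hw _) ht

end LTI

/-- A zooming quantizer for signals `ξ (k + 1) = dynamics (ξ k) + (bounded disturbance)`: `quantize`
replaces `dynamics x`, for `x` in the unit ball, by a nearby element of the finite `codebook`. -/
structure ZoomQuantizer (E : Type*) [NormedAddCommGroup E] [NormedSpace ℝ E] where
  dynamics : E →L[ℝ] E
  codebook : Finset E
  quantize : E → codebook
  norm_dynamics_sub_quantize_le : ∀ x, ‖x‖ ≤ 1 → ‖dynamics x - quantize x‖ ≤ 1 / 2

namespace ZoomQuantizer

/-- The memory of a zooming quantizer. The signal is believed to be within distance `scale ^ 2` of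
`estimate`: the scale grows at least as fast as the error during a zoom-out, so that its square
overtakes the error. -/
structure State (E : Type*) where
  estimate : E
  scale : ℝ

variable {E : Type*} [NormedAddCommGroup E] [NormedSpace ℝ E] (Z : ZoomQuantizer E)

/-- The factor of the scale in a zoom-out. -/
def gain : ℝ := ‖Z.dynamics‖ + 2

/-- The symbol sent for the value `x` of the signal; `none` reports that `x` is out of range. -/
def message (σ : State E) (x : E) : Option Z.codebook :=
  if ‖x - σ.estimate‖ ≤ σ.scale ^ 2 then
    some (Z.quantize ((σ.scale ^ 2)⁻¹ • (x - σ.estimate)))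
  else none

/-- The memory after a symbol. -/
def update (σ : State E) : Option Z.codebook → State E
  | some c => ⟨Z.dynamics σ.estimate + σ.scale ^ 2 • (c : E), σ.scale⟩
  | none => ⟨Z.dynamics σ.estimate, Z.gain * σ.scale⟩

/-- The memory of the receiver, computed from the symbols. -/
def decode (μ : ℕ → Option Z.codebook) : ℕ → State E
  | 0 => ⟨0, 1⟩
  | k + 1 => Z.update (decode μ k) (μ k)

/-- The memory of the sender, computed from the signal. -/
def encode (ξ : ℕ → E) : ℕ → State E
  | 0 => ⟨0, 1⟩
  | k + 1 => Z.update (encode ξ k) (Z.message (encode ξ k) (ξ k))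

theorem decode_congr {μ μ' : ℕ → Option Z.codebook} {k : ℕ} (h : ∀ j < k, μ j = μ' j) :
    Z.decode μ k = Z.decode μ' k := by
  induction k with
  | zero => rfl
  | succ k ih => rw [decode, decode, ih fun j hj => h j (hj.trans k.lt_succ_self),
      h k k.lt_succ_self]

theorem encode_congr {ξ ξ' : ℕ → E} {k : ℕ} (h : ∀ j < k, ξ j = ξ' j) :
    Z.encode ξ k = Z.encode ξ' k := by
  induction k with
  | zero => rfl
  | succ k ih => rw [encode, encode, ih fun j hj => h j (hj.trans k.lt_succ_self),
      h k k.lt_succ_self]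

theorem decode_message (ξ : ℕ → E) (k : ℕ) :
    Z.decode (fun j => Z.message (Z.encode ξ j) (ξ j)) k = Z.encode ξ k := by
  induction k with
  | zero => rfl
  | succ k ih => rw [decode, encode, ih]

variable {Z} {M : ℝ} {σ : State E} {x x' : E}

theorem scale_update_message_of_le (h : ‖x - σ.estimate‖ ≤ σ.scale ^ 2) :
    (Z.update σ (Z.message σ x)).scale = σ.scale := by
  rw [message, if_pos h, update]

theorem scale_update_message_of_lt (h : σ.scale ^ 2 < ‖x - σ.estimate‖) :
    (Z.update σ (Z.message σ x)).scale = Z.gain * σ.scale := by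
  rw [message, if_neg h.not_ge, update]

theorem norm_sub_estimate_update_le_of_le (hσ : σ.scale ≠ 0) (hx' : ‖x' - Z.dynamics x‖ ≤ M)
    (h : ‖x - σ.estimate‖ ≤ σ.scale ^ 2) :
    ‖x' - (Z.update σ (Z.message σ x)).estimate‖ ≤ M + σ.scale ^ 2 / 2 := by
  rw [message, if_pos h, update]
  have hρ : 0 < σ.scale ^ 2 := by positivity
  set ρ := σ.scale ^ 2
  set e := ρ⁻¹ • (x - σ.estimate) with he
  have he1 : ‖e‖ ≤ 1 := by
    rw [he, norm_smul, norm_inv, Real.norm_of_nonneg hρ.le]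
    exact inv_mul_le_one_of_le₀ h hρ.le
  have hx : x = σ.estimate + ρ • e := by
    rw [he, smul_inv_smul₀ hρ.ne', add_sub_cancel]
  have hsplit : x' - (Z.dynamics σ.estimate + ρ • (Z.quantize e : E)) =
      (x' - Z.dynamics x) + ρ • (Z.dynamics e - Z.quantize e) := by
    rw [hx, map_add, map_smul, smul_sub]
    abel
  calc ‖x' - (Z.dynamics σ.estimate + ρ • (Z.quantize e : E))‖
      ≤ M + ρ * ‖Z.dynamics e - Z.quantize e‖ := by
        rw [hsplit]
        refine norm_add_le_of_le hx' ?_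
        rw [norm_smul, Real.norm_of_nonneg hρ.le]
    _ ≤ M + ρ * (1 / 2) := by gcongr; exact Z.norm_dynamics_sub_quantize_le e he1
    _ = M + ρ / 2 := by ring

theorem norm_sub_estimate_update_le_of_lt (hx' : ‖x' - Z.dynamics x‖ ≤ M)
    (h : σ.scale ^ 2 < ‖x - σ.estimate‖) :
    ‖x' - (Z.update σ (Z.message σ x)).estimate‖ ≤ M + ‖Z.dynamics‖ * ‖x - σ.estimate‖ := by
  rw [message, if_neg h.not_ge, update, ← sub_add_sub_cancel x' (Z.dynamics x), ← map_sub]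
  exact norm_add_le_of_le hx' (Z.dynamics.le_opNorm _)

/-- The invariant of the quantizer under disturbances bounded by `M`: either the value `x` is in
range, or it is out of range and the scale is still small enough to be zoomed out. -/
structure Tracks (Z : ZoomQuantizer E) (M : ℝ) (σ : State E) (x : E) : Prop where
  one_le_scale : 1 ≤ σ.scale
  scale_le : σ.scale ≤ Z.gain * (3 * M + 1)
  norm_sub_le : ‖x - σ.estimate‖ + M ≤ (3 * M + 1) * σ.scale ∨ ‖x - σ.estimate‖ ≤ σ.scale ^ 2

theorem two_le_gain (Z : ZoomQuantizer E) : 2 ≤ Z.gain := le_add_of_nonneg_left (norm_nonneg _)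

theorem Tracks.update_of_le (h : Z.Tracks M σ x) (hx' : ‖x' - Z.dynamics x‖ ≤ M)
    (hx : ‖x - σ.estimate‖ ≤ σ.scale ^ 2) : Z.Tracks M (Z.update σ (Z.message σ x)) x' := by
  have hs := h.one_le_scale
  have herr := norm_sub_estimate_update_le_of_le (by positivity) hx' hx
  have hscale := scale_update_message_of_le (Z := Z) hx
  refine ⟨hscale ▸ hs, hscale ▸ h.scale_le, ?_⟩
  rw [hscale]
  rcases le_or_gt (2 * M) (σ.scale ^ 2) with hM | hM
  · right
    linarith
  · left
    nlinarith

theorem Tracks.update_of_lt (h : Z.Tracks M σ x) (hx' : ‖x' - Z.dynamics x‖ ≤ M)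
    (hx : σ.scale ^ 2 < ‖x - σ.estimate‖) : Z.Tracks M (Z.update σ (Z.message σ x)) x' := by
  have hM : 0 ≤ M := (norm_nonneg _).trans hx'
  have hs := h.one_le_scale
  have hgain := Z.two_le_gain
  have hleft := h.norm_sub_le.resolve_right hx.not_ge
  have hsG : σ.scale ≤ 3 * M + 1 := by nlinarith
  have hscale := scale_update_message_of_lt (Z := Z) hx
  have herr := norm_sub_estimate_update_le_of_lt hx' hx
  refine ⟨by rw [hscale]; nlinarith, by rw [hscale]; gcongr, Or.inl ?_⟩
  rw [hscale]
  calc ‖x' - (Z.update σ (Z.message σ x)).estimate‖ + M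
      ≤ Z.gain * (‖x - σ.estimate‖ + M) := by
        rw [gain]
        nlinarith [norm_nonneg (x - σ.estimate), norm_nonneg Z.dynamics]
    _ ≤ Z.gain * ((3 * M + 1) * σ.scale) := by gcongr
    _ = (3 * M + 1) * (Z.gain * σ.scale) := by ring

theorem tracks_encode {ξ : ℕ → E} (h₀ : ‖ξ 0‖ ≤ 1)
    (hξ : ∀ k, ‖ξ (k + 1) - Z.dynamics (ξ k)‖ ≤ M) (k : ℕ) :
    Z.Tracks M (Z.encode ξ k) (ξ k) := by
  induction k with
  | zero =>
    have hM : 0 ≤ M := (norm_nonneg _).trans (hξ 0)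
    have hgain := Z.two_le_gain
    exact ⟨le_rfl, by simp only [encode]; nlinarith, Or.inr (by simpa [encode] using h₀)⟩
  | succ k ih =>
    rcases le_or_gt ‖ξ k - (Z.encode ξ k).estimate‖ ((Z.encode ξ k).scale ^ 2) with h | h
    · exact ih.update_of_le (hξ k) h
    · exact ih.update_of_lt (hξ k) h

theorem Tracks.norm_sub_estimate_le (hM : 0 ≤ M) (h : Z.Tracks M σ x) :
    ‖x - σ.estimate‖ ≤
      (3 * M + 1) * (Z.gain * (3 * M + 1)) + (Z.gain * (3 * M + 1)) ^ 2 := by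
  have hs := h.one_le_scale
  have hgain := Z.two_le_gain
  rcases h.norm_sub_le with hx | hx
  · calc ‖x - σ.estimate‖ ≤ (3 * M + 1) * σ.scale := by linarith
      _ ≤ (3 * M + 1) * (Z.gain * (3 * M + 1)) := by gcongr; exact h.scale_le
      _ ≤ _ := le_add_of_nonneg_right (sq_nonneg _)
  · calc ‖x - σ.estimate‖ ≤ σ.scale ^ 2 := hx
      _ ≤ (Z.gain * (3 * M + 1)) ^ 2 := by gcongr; exact h.scale_le
      _ ≤ _ := le_add_of_nonneg_left (by positivity)

theorem exists_norm_sub_estimate_encode_le (Z : ZoomQuantizer E) (M : ℝ) :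
    ∃ K : ℝ, ∀ ξ : ℕ → E, ‖ξ 0‖ ≤ 1 → (∀ k, ‖ξ (k + 1) - Z.dynamics (ξ k)‖ ≤ M) →
      ∀ k, ‖ξ k - (Z.encode ξ k).estimate‖ ≤ K :=
  ⟨_, fun _ h₀ hξ k =>
    (tracks_encode h₀ hξ k).norm_sub_estimate_le ((norm_nonneg _).trans (hξ 0))⟩

end ZoomQuantizer

/-- The infinite sequence with the given first terms, continued by the constant `a`. -/
def extendSequence {α : Type*} (a : α) {t : ℕ} (y : Fin t → α) (i : ℕ) : α :=
  if h : i < t then y ⟨i, h⟩ else a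

theorem extendSequence_of_lt {α : Type*} (a : α) {t : ℕ} (y : ℕ → α) {i : ℕ} (h : i < t) :
    extendSequence a (fun j : Fin t => y j) i = y i := dif_pos h

/-- A block code of length `T` over the alphabet `X` that transmits the messages in `M` without
error, in a block of the channel `ch` starting at any time. -/
structure ZeroErrorBlockCode {S : Type*} (ch : FiniteStateErasureChannel S) (X M : Type*)
    (T : ℕ) where
  encode : M → Fin T → X
  decode : (Fin T → Option X) → M
  decode_erasureOutput : ∀ z ∈ ch.noiseSequences, ∀ (μ : M) (t₀ : ℕ),
    decode (fun i : Fin T => erasureOutput (encode μ i) (z (t₀ + i))) = μ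

/-- The data of a coder-estimator working in blocks of length `T`: a left inverse of the
observability matrix to observe the state once per block, a zooming quantizer for the observed
states, and a code that transmits one symbol of the quantizer per block. -/
structure BlockZoomScheme {n m : ℕ} {S : Type*} (A : Matrix (Fin n) (Fin n) ℝ)
    (C : Matrix (Fin m) (Fin n) ℝ) (ch : FiniteStateErasureChannel S) (X : Type*) (T : ℕ) where
  observer : Matrix (Fin n) (Fin n × Fin m) ℝ
  observer_mul : observer * LTI.observabilityMatrix C A = 1
  quantizer : ZoomQuantizer (Fin n → ℝ)
  dynamics_apply : ∀ x, quantizer.dynamics x = A ^ T *ᵥ x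
  code : ZeroErrorBlockCode ch X (Option quantizer.codebook) T

namespace BlockZoomScheme

open scoped Matrix.Norms.Operator

variable {n m : ℕ} {X S : Type*} {A : Matrix (Fin n) (Fin n) ℝ} {C : Matrix (Fin m) (Fin n) ℝ}
  {ch : FiniteStateErasureChannel S} {T : ℕ}

section Coder

variable (P : BlockZoomScheme A C ch X T)

/-- The observed state at the time `k * T`. -/
def observed (y : ℕ → Fin m → ℝ) (k : ℕ) : Fin n → ℝ :=
  LTI.blockObserver A P.observer T y k

/-- The symbol of the quantizer that is transmitted in the `k`-th block. -/
def symbol (y : ℕ → Fin m → ℝ) (k : ℕ) : Option P.quantizer.codebook :=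
  P.quantizer.message (P.quantizer.encode (P.observed y) k) (P.observed y k)

/-- The coder-estimator given by the scheme. -/
def coderEstimator (hT : 0 < T) : CoderEstimator n m X where
  encode t y := P.code.encode (P.symbol (extendSequence 0 y) (t / T)) ⟨t % T, t.mod_lt hT⟩
  estimate t Q := A ^ ((t + 1) % T) *ᵥ (P.quantizer.decode
    (fun k => P.code.decode fun i => extendSequence none Q (k * T + i)) ((t + 1) / T)).estimate

theorem symbol_congr (hnT : n ≤ T) {y y' : ℕ → Fin m → ℝ} {k : ℕ} (h : ∀ t < k * T, y t = y' t) :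
    P.symbol y k = P.symbol y' k := by
  have hobs {j : ℕ} (hj : j ≤ k) : P.observed y j = P.observed y' j :=
    LTI.blockObserver_congr hnT fun t ht => h t (ht.trans_le (Nat.mul_le_mul_right T hj))
  rw [symbol, symbol, hobs le_rfl, P.quantizer.encode_congr fun j hj => hobs hj.le]

variable {P}

theorem coderEstimator_encode (hT : 0 < T) (hnT : n ≤ T) (y : ℕ → Fin m → ℝ) (t : ℕ) :
    (P.coderEstimator hT).encode t (fun i => y i) =
      P.code.encode (P.symbol y (t / T)) ⟨t % T, t.mod_lt hT⟩ := by
  refine congrArg (fun μ => P.code.encode μ _) (P.symbol_congr hnT fun s hs => ?_)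
  exact extendSequence_of_lt 0 y (hs.trans_le ((Nat.div_mul_le_self t T).trans t.le_succ))

theorem decode_received_block (hT : 0 < T) (hnT : n ≤ T) {z : ℕ → Bool}
    (hz : z ∈ ch.noiseSequences) (y : ℕ → Fin m → ℝ) (k : ℕ) :
    P.code.decode (fun i => (P.coderEstimator hT).received y z (k * T + i)) = P.symbol y k := by
  rw [← P.code.decode_erasureOutput z hz (P.symbol y k) (k * T)]
  congr! 2 with i
  rw [CoderEstimator.received, coderEstimator_encode hT hnT]
  have hdiv : (k * T + i) / T = k := by
    rw [mul_comm, Nat.mul_add_div hT, Nat.div_eq_of_lt i.isLt, add_zero]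
  have hmod : (k * T + i) % T = i := Nat.mul_add_mod_of_lt i.isLt
  simp only [hdiv, hmod]

theorem coderEstimator_stateEstimate (hT : 0 < T) (hnT : n ≤ T) {z : ℕ → Bool}
    (hz : z ∈ ch.noiseSequences) (y : ℕ → Fin m → ℝ) (t : ℕ) :
    (P.coderEstimator hT).stateEstimate y z t =
      A ^ (t % T) *ᵥ (P.quantizer.encode (P.observed y) (t / T)).estimate := by
  cases t with
  | zero => simp [CoderEstimator.stateEstimate, ZoomQuantizer.encode]
  | succ t =>
    rw [CoderEstimator.stateEstimate, ← P.quantizer.decode_message]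
    refine congrArg (fun σ : ZoomQuantizer.State (Fin n → ℝ) => A ^ ((t + 1) % T) *ᵥ σ.estimate)
      (P.quantizer.decode_congr fun k hk => ?_)
    refine Eq.trans ?_ (decode_received_block hT hnT hz y k)
    congr! 2 with i
    refine extendSequence_of_lt none ((P.coderEstimator hT).received y z) ?_
    calc k * T + i < (k + 1) * T := by rw [Nat.succ_mul]; omega
      _ ≤ (t + 1) / T * T := Nat.mul_le_mul_right T hk
      _ ≤ t + 1 := Nat.div_mul_le_self _ _

end Coder

variable {x₀ : Fin n → ℝ} {v : ℕ → Fin n → ℝ} {M K : ℝ}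

theorem norm_sub_pow_mulVec_le (hv : ∀ t, ‖v t‖ ≤ M) {ξ : ℕ → Fin n → ℝ}
    (hξ : ∀ k, ‖ξ k - LTI.state A x₀ v (k * T)‖ ≤ K) (k : ℕ) :
    ‖ξ (k + 1) - A ^ T *ᵥ ξ k‖ ≤
      K + ‖A ^ T‖ * K + M * ∑ i ∈ Finset.range T, ‖A‖ ^ i := by
  have hsplit : ξ (k + 1) - A ^ T *ᵥ ξ k =
      (ξ (k + 1) - LTI.state A x₀ v ((k + 1) * T)) -
        A ^ T *ᵥ (ξ k - LTI.state A x₀ v (k * T)) +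
      LTI.state A 0 (fun i => v (k * T + i)) T := by
    rw [Nat.succ_mul, LTI.state_add, Matrix.mulVec_sub]
    abel
  rw [hsplit]
  refine norm_add_le_of_le (norm_sub_le_of_le (hξ _) ?_)
    (LTI.norm_state_zero_le (fun i => hv (k * T + i)) T)
  exact (Matrix.linfty_opNorm_mulVec _ _).trans (by gcongr; exact hξ k)

theorem norm_pow_mulVec_sub_state_le (hT : 0 < T) (hv : ∀ t, ‖v t‖ ≤ M) (t : ℕ) {x : Fin n → ℝ}
    (hx : ‖x - LTI.state A x₀ v (t / T * T)‖ ≤ K) :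
    ‖A ^ (t % T) *ᵥ x - LTI.state A x₀ v t‖ ≤
      (∑ i ∈ Finset.range T, ‖A ^ i‖) * K + M * ∑ i ∈ Finset.range T, ‖A‖ ^ i := by
  have hr : t % T < T := t.mod_lt hT
  have hpow : ‖A ^ (t % T)‖ ≤ ∑ i ∈ Finset.range T, ‖A ^ i‖ :=
    Finset.single_le_sum (f := fun i => ‖A ^ i‖) (fun _ _ => norm_nonneg _)
      (Finset.mem_range.2 hr)
  have hstate := LTI.state_add (A := A) (v := v) x₀ (t / T * T) (t % T)
  rw [Nat.div_add_mod'] at hstate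
  rw [hstate, ← sub_sub, ← Matrix.mulVec_sub]
  refine norm_sub_le_of_le ((Matrix.linfty_opNorm_mulVec _ _).trans ?_)
    (LTI.norm_state_zero_le_of_le (fun _ => hv _) hr.le)
  gcongr

theorem uniformlyBoundedErrors (P : BlockZoomScheme A C ch X T) (hT : 0 < T) (hnT : n ≤ T) :
    (P.coderEstimator hT).UniformlyBoundedErrors A C ch := by
  rintro RV RW ⟨MV, hMV⟩ ⟨MW, hMW⟩
  refine ⟨1, one_pos, fun RX hRX => ?_⟩
  set M := max 1 (max MV MW) with hM
  obtain ⟨K₁, hobserver⟩ := LTI.exists_norm_blockObserver_sub_state_le P.observer_mul hnT M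
  obtain ⟨K₂, hquantizer⟩ := P.quantizer.exists_norm_sub_estimate_encode_le
    (K₁ + ‖A ^ T‖ * K₁ + M * ∑ i ∈ Finset.range T, ‖A‖ ^ i)
  refine ⟨(∑ i ∈ Finset.range T, ‖A ^ i‖) * (K₂ + K₁) + M * ∑ i ∈ Finset.range T, ‖A‖ ^ i,
    fun x₀ hx₀ v hv w hw z hz t => ?_⟩
  have hx₀M : ‖x₀‖ ≤ M := (mem_closedBall_zero_iff.1 (hRX hx₀)).trans (le_max_left _ _)
  have hvM (t : ℕ) : ‖v t‖ ≤ M := (hMV v hv t).trans (by simp [hM])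
  have hwM (t : ℕ) : ‖w t‖ ≤ M := (hMW w hw t).trans (by simp [hM])
  set ξ := P.observed (LTI.output A C x₀ v w) with hξ
  have hobs : ∀ k, ‖ξ k - LTI.state A x₀ v (k * T)‖ ≤ K₁ := hobserver x₀ v w hx₀M hvM hwM
  have hquant (k : ℕ) : ‖ξ k - (P.quantizer.encode ξ k).estimate‖ ≤ K₂ :=
    hquantizer ξ (by simp [hξ, observed, LTI.blockObserver])
      (fun k => by rw [P.dynamics_apply]; exact norm_sub_pow_mulVec_le hvM hobs k) k
  rw [CoderEstimator.estimationError, coderEstimator_stateEstimate hT hnT hz]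
  refine norm_pow_mulVec_sub_state_le hT hvM t ?_
  exact (norm_sub_le_norm_sub_add_norm_sub _ (ξ (t / T)) _).trans
    (add_le_add (norm_sub_rev _ (ξ (t / T)) ▸ hquant _) (hobs _))

end BlockZoomScheme

theorem eventually_mul_pow_add_one_le {R R' : ℝ} (L : ℝ) (hR : 0 ≤ R) (hRR' : R < R')
    (hR' : 1 < R') : ∀ᶠ T : ℕ in Filter.atTop, L * R ^ T + 1 ≤ R' ^ T := by
  have hone := isLittleO_pow_pow_of_lt_left zero_le_one hR'
  filter_upwards [(((isLittleO_pow_pow_of_lt_left hR hRR').const_mul_left L).add hone).bound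
    one_pos] with T hT
  rw [one_pow, one_mul, Real.norm_of_nonneg (pow_nonneg (hR.trans hRR'.le) T)] at hT
  exact (le_abs_self _).trans hT

theorem FiniteStateErasureChannel.nonempty_zeroErrorBlockCode {X S : Type*} [Fintype S]
    {ch : FiniteStateErasureChannel S} {T : ℕ} {code : Finset (Fin T → X)}
    (hcode : IsZeroErrorCode (ch.noiseWords T) code) {M : Type*} [Fintype M] [Nonempty M]
    (hM : Fintype.card M ≤ code.card) : Nonempty (ZeroErrorBlockCode ch X M T) := by
  obtain ⟨enc, dec, h⟩ := hcode.exists_decoder hM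
  exact ⟨⟨enc, dec, fun z hz μ t₀ => h _ (ch.restrict_mem_noiseWords hz t₀ T) μ⟩⟩

section Existence

open Filter

variable {n m : ℕ} {X S : Type*} [Fintype X] [Fintype S] [Nonempty S]
  {A : Matrix (Fin n) (Fin n) ℝ} {C : Matrix (Fin m) (Fin n) ℝ}

theorem unstableProduct_mul_perronEigenvalue_mul_lt (hq : 2 ≤ Fintype.card X)
    {ch : FiniteStateErasureChannel S}
    (h : LTI.topologicalEntropy A (Fintype.card X) + ch.topologicalEntropy (Fintype.card X)
      + ch.maximalRatio < 1) :
    LTI.unstableProduct A * ch.perronEigenvalue * (Fintype.card X : ℝ) ^ ch.maximalRatio <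
      Fintype.card X := by
  have hq1 : (1 : ℝ) < Fintype.card X := by exact_mod_cast hq
  have hΛ := LTI.one_le_unstableProduct A
  have hch := ch.one_le_perronEigenvalue
  refine (Real.logb_lt_logb_iff hq1 (by positivity) (by positivity)).1 ?_
  rw [Real.logb_self_eq_one hq1, Real.logb_mul (by positivity) (by positivity),
    Real.logb_mul (by positivity) (by positivity), Real.logb_rpow (by positivity) hq1.ne',
    ← LTI.topologicalEntropy_eq_logb]
  exact h

theorem exists_zoomQuantizer {T : ℕ} {F : Finset (Fin n → ℝ)}
    (hF : ∀ x : Fin n → ℝ, ‖x‖ ≤ 1 → ∃ c ∈ F, ‖A ^ T *ᵥ x - c‖ ≤ 1 / 2) :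
    ∃ Z : ZoomQuantizer (Fin n → ℝ), Z.codebook = F ∧ ∀ x, Z.dynamics x = A ^ T *ᵥ x := by
  obtain ⟨c₀, hc₀, -⟩ := hF 0 (by simp)
  have hquantize (x : Fin n → ℝ) : ∃ c : F, ‖x‖ ≤ 1 → ‖A ^ T *ᵥ x - c‖ ≤ 1 / 2 := by
    by_cases hx : ‖x‖ ≤ 1
    · obtain ⟨c, hc, hxc⟩ := hF x hx
      exact ⟨⟨c, hc⟩, fun _ => hxc⟩
    · exact ⟨⟨c₀, hc₀⟩, fun h => absurd h hx⟩
  choose κ hκ using hquantize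
  exact ⟨⟨LinearMap.toContinuousLinearMap (A ^ T).mulVecLin, F, κ, hκ⟩, rfl, fun _ => rfl⟩

theorem exists_blockZoomScheme (hq : 2 ≤ Fintype.card X) (hobs : LTI.Observable C A)
    (ch : FiniteStateErasureChannel S)
    (h : LTI.topologicalEntropy A (Fintype.card X) + ch.topologicalEntropy (Fintype.card X)
      + ch.maximalRatio < 1) :
    ∃ T, 0 < T ∧ n ≤ T ∧ Nonempty (BlockZoomScheme A C ch X T) := by
  have hΛ := LTI.one_le_unstableProduct A
  have hch := ch.one_le_perronEigenvalue
  have : (0 : ℝ) < Fintype.card X := by exact_mod_cast (by omega : 0 < Fintype.card X)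
  obtain ⟨R', hΛR', hR'q⟩ : ∃ R' > LTI.unstableProduct A,
      R' * ch.perronEigenvalue * (Fintype.card X : ℝ) ^ ch.maximalRatio < Fintype.card X := by
    have hlt := unstableProduct_mul_perronEigenvalue_mul_lt hq h
    simp only [mul_assoc, ← lt_div_iff₀ (show 0 < ch.perronEigenvalue *
      (Fintype.card X : ℝ) ^ ch.maximalRatio by positivity)] at hlt ⊢
    exact exists_between hlt
  obtain ⟨R, hΛR, hRR'⟩ := exists_between hΛR'
  have hR : 1 < R := hΛ.trans_lt hΛR
  obtain ⟨L, hcover⟩ := LTI.exists_finset_cover_image_pow A hΛR (ε := 1 / 2) (by positivity)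
  obtain ⟨T, ⟨code, hcode, hcard⟩, hLR, hnT⟩ :=
    ((ch.eventually_exists_isZeroErrorCode (by linarith) hR'q).and
      ((eventually_mul_pow_add_one_le L (by linarith) hRR' (hR.trans hRR')).and
        (eventually_ge_atTop (n + 1)))).exists
  obtain ⟨F, hFcard, hF⟩ := hcover T
  obtain ⟨Z, rfl, hdyn⟩ := exists_zoomQuantizer (by simpa using hF)
  obtain ⟨D, hD⟩ := hobs.exists_leftInverse
  have hsymbols : Fintype.card (Option Z.codebook) ≤ code.card := by
    rw [Fintype.card_option, Fintype.card_coe]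
    have : (Z.codebook.card : ℝ) + 1 ≤ code.card := by linarith
    exact_mod_cast this
  obtain ⟨B⟩ := ch.nonempty_zeroErrorBlockCode hcode hsymbols
  exact ⟨T, by omega, by omega, ⟨⟨D, hD, Z, hdyn, B⟩⟩⟩

end Existence

namespace LTI

open MeasureTheory Metric Polynomial
open scoped Matrix.Norms.Operator ENNReal

variable {n : ℕ}

theorem exists_volume_setOf_norm_sub_pow_mulVec_le (A : Matrix (Fin n) (Fin n) ℝ) (l K : ℝ) :
    ∃ c : ℝ≥0∞, c ≠ ∞ ∧ ∀ (t : ℕ) (a : Fin n → ℝ),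
      volume {x : Fin n → ℝ | ‖x‖ ≤ l ∧ ‖a - A ^ t *ᵥ x‖ ≤ K} ≤
        ENNReal.ofReal (unstableProduct A ^ t)⁻¹ * c := by
  obtain ⟨g, hg⟩ := exists_polynomial_aeval_eigenvalues A
  set P := aeval A g with hP
  refine ⟨volume (closedBall (0 : Fin n → ℝ) (‖P‖ * K + ‖1 - P‖ * l)),
    measure_closedBall_lt_top.ne, fun t a => ?_⟩
  set Φ := aeval A (X ^ t * g + (1 - g)) with hΦ
  have hΦP : Φ = P * A ^ t + (1 - P) := by
    rw [hΦ, mul_comm]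
    simp [hP]
  have hdet : |Φ.det| = unstableProduct A ^ t := abs_det_aeval_X_pow_mul_add hg t
  have hsub : {x : Fin n → ℝ | ‖x‖ ≤ l ∧ ‖a - A ^ t *ᵥ x‖ ≤ K} ⊆
      Φ.mulVec ⁻¹' closedBall (P *ᵥ a) (‖P‖ * K + ‖1 - P‖ * l) := by
    rintro x ⟨hx, hxa⟩
    have hsplit : Φ *ᵥ x - P *ᵥ a = P *ᵥ (A ^ t *ᵥ x - a) + (1 - P) *ᵥ x := by
      rw [hΦP, Matrix.add_mulVec, ← Matrix.mulVec_mulVec, Matrix.mulVec_sub]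
      abel
    rw [Set.mem_preimage, mem_closedBall, dist_eq_norm, hsplit]
    rw [norm_sub_rev] at hxa
    exact norm_add_le_of_le ((Matrix.linfty_opNorm_mulVec _ _).trans (by gcongr))
      ((Matrix.linfty_opNorm_mulVec _ _).trans (by gcongr))
  have hdet_ne : Φ.det ≠ 0 := by
    have := one_le_unstableProduct A
    rw [← abs_pos, hdet]
    positivity
  calc volume {x : Fin n → ℝ | ‖x‖ ≤ l ∧ ‖a - A ^ t *ᵥ x‖ ≤ K}
      ≤ volume (Φ.mulVec ⁻¹' closedBall (P *ᵥ a) (‖P‖ * K + ‖1 - P‖ * l)) := measure_mono hsub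
    _ = ENNReal.ofReal (unstableProduct A ^ t)⁻¹ *
          volume (closedBall (0 : Fin n → ℝ) (‖P‖ * K + ‖1 - P‖ * l)) := by
        rw [volume_preimage_mulVec hdet_ne, hdet, Measure.addHaar_closedBall_center]

end LTI

theorem count_mul_of_periodic {p : ℕ → Prop} [DecidablePred p] {d : ℕ}
    (hp : Function.Periodic p d) (j : ℕ) : Nat.count p (d * j) = Nat.count p d * j := by
  induction j with
  | zero => simp
  | succ j ih =>
    have hshift : (fun t => p (d * j + t)) = p := by
      funext t
      simpa [mul_comm, add_comm] using hp.nat_mul j t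
    rw [mul_add_one, Nat.count_add, ih, mul_add_one]
    simp only [hshift]

theorem count_eq_false_add_count_eq_true (z : ℕ → Bool) (T : ℕ) :
    Nat.count (fun t => z t = false) T + Nat.count (fun t => z t = true) T = T := by
  have h := Finset.card_filter_add_card_filter_not (s := Finset.range T) fun t => z t = false
  simpa [Nat.count_eq_card_filter_range] using h

namespace FiniteStateErasureChannel

variable {S : Type*} {ch : FiniteStateErasureChannel S}

theorem IsCycle.exists_periodic_noise {k : ℕ} {p : Fin (k + 1) → S} (hp : ch.IsCycle p) :
    ∃ z ∈ ch.noiseSequences, Function.Periodic z (k + 1) ∧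
      ch.cycleRatio p * (k + 1 : ℕ) = Nat.count (fun t => z t = true) (k + 1) := by
  let s (t : ℕ) : S := p (Fin.ofNat (k + 1) t)
  have hsucc (t : ℕ) : s (t + 1) = p (Fin.ofNat (k + 1) t + 1) :=
    congrArg p (Fin.ext (by simp [Fin.val_add]))
  have hper (t : ℕ) : s (t + (k + 1)) = s t := congrArg p (Fin.ext (by simp))
  refine ⟨fun t => ch.noise (s t) (s (t + 1)), ⟨s, fun t => ⟨?_, rfl⟩⟩, fun t => ?_, ?_⟩
  · exact hsucc t ▸ hp.2 _
  · simp only [hper, add_right_comm t (k + 1) 1]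
  · have hratio := cycleRatio_window_mul (ch := ch) (i := 0) (hper 0)
    simpa [s, erasures] using hratio

theorem exists_periodic_noise_of_lt_maximalRatio [Finite S] [Nonempty S] {r : ℝ}
    (hr : r < ch.maximalRatio) :
    ∃ z ∈ ch.noiseSequences, ∃ d : ℕ, Function.Periodic z d ∧
      r * d < Nat.count (fun t => z t = true) d := by
  obtain ⟨k₀, p₀, hp₀⟩ := ch.exists_isCycle
  obtain ⟨_, ⟨k, p, hp, rfl⟩, hrp⟩ := exists_lt_of_lt_csSup
    (s := {r | ∃ (k : ℕ) (p : Fin (k + 1) → S), ch.IsCycle p ∧ r = ch.cycleRatio p})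
    ⟨_, k₀, p₀, hp₀, rfl⟩ hr
  obtain ⟨z, hz, hper, hcount⟩ := hp.exists_periodic_noise
  refine ⟨z, hz, k + 1, hper, ?_⟩
  rw [← hcount]
  gcongr

end FiniteStateErasureChannel

namespace CoderEstimator

open Filter MeasureTheory Topology

variable {n m : ℕ} {X : Type*} [Fintype X] (ce : CoderEstimator n m X)
  (A : Matrix (Fin n) (Fin n) ℝ) (C : Matrix (Fin m) (Fin n) ℝ) {z : ℕ → Bool}

theorem exists_finset_stateEstimate_mem (z : ℕ → Bool) (T : ℕ) :
    ∃ F : Finset (Fin n → ℝ), F.card ≤ Fintype.card X ^ Nat.count (fun t => z t = false) T ∧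
      ∀ y, ce.stateEstimate y z T ∈ F := by
  classical
  cases T with
  | zero => exact ⟨{0}, by simp, fun _ => Finset.mem_singleton_self _⟩
  | succ t =>
    let outputs (i : Fin (t + 1)) : Finset (Option X) :=
      if z i = false then Finset.univ.image some else {none}
    refine ⟨(Fintype.piFinset outputs).image (ce.estimate t), ?_, fun y => ?_⟩
    · refine Finset.card_image_le.trans_eq ?_
      rw [Fintype.card_piFinset, Nat.count_eq_card_filter_range, Finset.card_filter,
        Finset.sum_range, ← Finset.prod_pow_eq_pow_sum]
      refine Finset.prod_congr rfl fun i _ => ?_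
      by_cases hi : z i = false <;>
        simp [outputs, hi, Finset.card_image_of_injective _ (Option.some_injective X)]
    · refine Finset.mem_image.2
        ⟨fun i => ce.received y z i, Fintype.mem_piFinset.2 fun i => ?_, rfl⟩
      by_cases hi : z i = false <;> simp [outputs, received, erasureOutput, hi]

theorem volume_bounded_estimationError_le {v : ℕ → Fin n → ℝ} {w : ℕ → Fin m → ℝ} (l K : ℝ) :
    ∃ c : ENNReal, c ≠ ⊤ ∧ ∀ T,
      volume {x₀ | ‖x₀‖ ≤ l ∧ ∀ t, ‖ce.estimationError A C x₀ v w z t‖ ≤ K} ≤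
        ENNReal.ofReal (Fintype.card X ^ Nat.count (fun t => z t = false) T /
          LTI.unstableProduct A ^ T) * c := by
  obtain ⟨c, hc, hvol⟩ := LTI.exists_volume_setOf_norm_sub_pow_mulVec_le A l K
  refine ⟨c, hc, fun T => ?_⟩
  have hΛ := LTI.one_le_unstableProduct A
  obtain ⟨F, hF, hmem⟩ := ce.exists_finset_stateEstimate_mem z T
  have hsub : {x₀ | ‖x₀‖ ≤ l ∧ ∀ t, ‖ce.estimationError A C x₀ v w z t‖ ≤ K} ⊆
      ⋃ a ∈ F, {x | ‖x‖ ≤ l ∧ ‖a - LTI.state A 0 v T - A ^ T *ᵥ x‖ ≤ K} := by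
    rintro x₀ ⟨hx₀, hK⟩
    refine Set.mem_iUnion₂.2 ⟨_, hmem (LTI.output A C x₀ v w), hx₀, ?_⟩
    have := hK T
    rwa [estimationError, LTI.state_eq_pow_mulVec_add, ← sub_sub, sub_right_comm] at this
  calc volume {x₀ | ‖x₀‖ ≤ l ∧ ∀ t, ‖ce.estimationError A C x₀ v w z t‖ ≤ K}
      ≤ ∑ a ∈ F, volume {x | ‖x‖ ≤ l ∧ ‖a - LTI.state A 0 v T - A ^ T *ᵥ x‖ ≤ K} :=
        (measure_mono hsub).trans (measure_biUnion_finset_le _ _)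
    _ ≤ ∑ _a ∈ F, ENNReal.ofReal (LTI.unstableProduct A ^ T)⁻¹ * c := by
        gcongr
        exact hvol _ _
    _ = ENNReal.ofReal (F.card / LTI.unstableProduct A ^ T) * c := by
        rw [Finset.sum_const, nsmul_eq_mul, ← mul_assoc, div_eq_mul_inv,
          ENNReal.ofReal_mul (by positivity), ENNReal.ofReal_natCast]
    _ ≤ _ := by
        gcongr
        exact_mod_cast hF

theorem ae_not_bddAbove_estimationError {f : Filter ℕ} [f.NeBot]
    (hf : Tendsto (fun T => (Fintype.card X : ℝ) ^ Nat.count (fun t => z t = false) T /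
      LTI.unstableProduct A ^ T) f (𝓝 0)) (v : ℕ → Fin n → ℝ) (w : ℕ → Fin m → ℝ) :
    ∀ᵐ x₀, ¬ BddAbove (Set.range fun t => ‖ce.estimationError A C x₀ v w z t‖) := by
  have hnull (N : ℕ) :
      volume {x₀ | ‖x₀‖ ≤ N ∧ ∀ t, ‖ce.estimationError A C x₀ v w z t‖ ≤ N} = 0 := by
    obtain ⟨c, hc, hle⟩ :=
      ce.volume_bounded_estimationError_le A C (z := z) (v := v) (w := w) N N
    have hlim := ENNReal.Tendsto.mul_const (ENNReal.tendsto_ofReal hf) (Or.inr hc)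
    rw [ENNReal.ofReal_zero, zero_mul] at hlim
    exact le_antisymm (ge_of_tendsto' hlim hle) zero_le
  refine measure_mono_null (fun x₀ hx₀ => ?_) (measure_iUnion_null hnull)
  obtain ⟨B, hB⟩ := not_not.1 hx₀
  obtain ⟨N, hN⟩ := exists_nat_ge (max ‖x₀‖ B)
  exact Set.mem_iUnion.2 ⟨N, (le_max_left _ _).trans hN, fun t =>
    (hB (Set.mem_range_self t)).trans ((le_max_right _ _).trans hN)⟩

theorem ae_not_bddAbove_estimationError_of_periodic {d : ℕ} (hz : Function.Periodic z d)
    (hlt : (Fintype.card X : ℝ) ^ Nat.count (fun t => z t = false) d < LTI.unstableProduct A ^ d)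
    (v : ℕ → Fin n → ℝ) (w : ℕ → Fin m → ℝ) :
    ∀ᵐ x₀, ¬ BddAbove (Set.range fun t => ‖ce.estimationError A C x₀ v w z t‖) := by
  refine ce.ae_not_bddAbove_estimationError A C (f := map (fun j => d * j) atTop)
    (tendsto_map'_iff.2 ?_) v w
  have hΛ := LTI.one_le_unstableProduct A
  have hper : Function.Periodic (fun t => z t = false) d := hz.comp (· = false)
  have hcount (j : ℕ) : (Fintype.card X : ℝ) ^ Nat.count (fun t => z t = false) (d * j) /
      LTI.unstableProduct A ^ (d * j) =
      (Fintype.card X ^ Nat.count (fun t => z t = false) d / LTI.unstableProduct A ^ d) ^ j := by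
    rw [count_mul_of_periodic hper, pow_mul, pow_mul, div_pow]
  simp only [Function.comp_def, hcount]
  exact tendsto_pow_atTop_nhds_zero_of_lt_one (by positivity) ((div_lt_one (by positivity)).2 hlt)

end CoderEstimator

section Converse

open MeasureTheory

theorem exists_noise_forall_ae_not_bddAbove {n m : ℕ} {X S : Type*} [Fintype X] [Finite S]
    [Nonempty S] (hq : 2 ≤ Fintype.card X) (A : Matrix (Fin n) (Fin n) ℝ)
    (C : Matrix (Fin m) (Fin n) ℝ) (ch : FiniteStateErasureChannel S)
    (h : 1 < LTI.topologicalEntropy A (Fintype.card X) + ch.maximalRatio) :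
    ∃ z ∈ ch.noiseSequences, ∀ (ce : CoderEstimator n m X) (v : ℕ → Fin n → ℝ)
      (w : ℕ → Fin m → ℝ), ∀ᵐ x₀,
        ¬ BddAbove (Set.range fun t => ‖ce.estimationError A C x₀ v w z t‖) := by
  have hq1 : (1 : ℝ) < Fintype.card X := by exact_mod_cast hq
  have hΛ := LTI.one_le_unstableProduct A
  obtain ⟨z, hz, d, hper, hcount⟩ :=
    ch.exists_periodic_noise_of_lt_maximalRatio (sub_lt_iff_lt_add'.2 h)
  refine ⟨z, hz, fun ce => ce.ae_not_bddAbove_estimationError_of_periodic A C hper ?_⟩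
  have hsum : (Nat.count (fun t => z t = false) d : ℝ) + Nat.count (fun t => z t = true) d = d := by
    exact_mod_cast count_eq_false_add_count_eq_true z d
  rw [← Real.rpow_natCast, ← Real.lt_logb_iff_rpow_lt hq1 (by positivity), Real.logb_pow,
    ← LTI.topologicalEntropy_eq_logb]
  linarith

end Converse

end

theorem exists_mem_closedBall_of_ae {n : ℕ} {p : (Fin n → ℝ) → Prop} (hp : ∀ᵐ x, p x)
    (c : Fin n → ℝ) {l : ℝ} (hl : 0 < l) : ∃ x ∈ Metric.closedBall c l, p x := by
  obtain ⟨x, hx, hpx⟩ := Metric.dense_iff.1 (MeasureTheory.Measure.dense_of_ae hp) c l hl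
  exact ⟨x, Metric.ball_subset_closedBall hx, hpx⟩

theorem proposition2_general {n m : ℕ} {X S : Type*} [Fintype X] [Fintype S] [Nonempty S]
    (hq : 2 ≤ Fintype.card X) (A : Matrix (Fin n) (Fin n) ℝ) (C : Matrix (Fin m) (Fin n) ℝ)
    (ch : FiniteStateErasureChannel S) :
    (LTI.Observable C A →
      LTI.topologicalEntropy A (Fintype.card X) + ch.topologicalEntropy (Fintype.card X)
          + ch.maximalRatio < 1 →
        ∃ ce : CoderEstimator n m X, ce.UniformlyBoundedErrors A C ch) ∧
    (1 < LTI.topologicalEntropy A (Fintype.card X) + ch.maximalRatio →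
      ∃ z ∈ ch.noiseSequences, ∀ (ce : CoderEstimator n m X) (v : ℕ → Fin n → ℝ)
        (w : ℕ → Fin m → ℝ), ∀ᵐ x₀,
          ¬ BddAbove (Set.range fun t => ‖ce.estimationError A C x₀ v w z t‖)) := by
  refine ⟨fun hobs h => ?_, exists_noise_forall_ae_not_bddAbove hq A C ch⟩
  obtain ⟨T, hT, hnT, ⟨P⟩⟩ := exists_blockZoomScheme hq hobs ch h
  exact ⟨P.coderEstimator hT, P.uniformlyBoundedErrors hT hnT⟩

theorem proposition2 {n m : ℕ} {X S : Type*} [Fintype X] [Fintype S] [Nonempty S]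
    (hq : 2 ≤ Fintype.card X)
    (A : Matrix (Fin n) (Fin n) ℝ) (C : Matrix (Fin m) (Fin n) ℝ)
    (hobs : LTI.Observable C A)
    (hunst : ∃ z ∈ LTI.eigenvalues A, 1 < ‖z‖)
    (ch : FiniteStateErasureChannel S) :
    (LTI.topologicalEntropy A (Fintype.card X) + ch.topologicalEntropy (Fintype.card X)
        + ch.maximalRatio < 1 →
      ∃ ce : CoderEstimator n m X, ce.UniformlyBoundedErrors A C ch) ∧
    (1 < LTI.topologicalEntropy A (Fintype.card X) + ch.maximalRatio →
      ∀ (RV : Set (ℕ → Fin n → ℝ)) (RW : Set (ℕ → Fin m → ℝ)),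
        LTI.UniformlyBoundedSignals RV → LTI.UniformlyBoundedSignals RW →
        0 ∈ RV → 0 ∈ RW →
        ∃ v ∈ RV, ∃ w ∈ RW, ∀ (ce : CoderEstimator n m X) (l : ℝ), 0 < l →
          ∃ x₀ ∈ Metric.closedBall (0 : Fin n → ℝ) l, ∃ z ∈ ch.noiseSequences,
            ¬ BddAbove (Set.range fun t => ‖ce.estimationError A C x₀ v w z t‖)) := by
  refine ⟨(proposition2_general hq A C ch).1 hobs, fun h RV RW _ _ hV hW => ?_⟩
  obtain ⟨z, hz, hae⟩ := (proposition2_general (m := m) hq A C ch).2 h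
  exact ⟨0, hV, 0, hW, fun ce l hl =>
    (exists_mem_closedBall_of_ae (hae ce 0 0) 0 hl).imp fun _ hx => ⟨hx.1, z, hz, hx.2⟩⟩
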